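/- Let $n\ge 0$ and let $m_1\le m_2\le\dots\le m_n$ be integers with $i\le m_i\le n$ for all $i$. Let $P$ be the corresponding natural unit interval order, that is, the poset on $[n]=\{1,\dots,n\}$ with $i<_P j$ if and only if $m_i<j$, and let $\mathrm{inc}(P)$ be its incomparability graph, the graph on $[n]$ in which two vertices are adjacent if and only if they are incomparable in $P$. Let $$X_P(\mathbf x,q)=\sum_{\kappa} q^{\mathrm{asc}(\kappa)}\prod_{i=1}^n x_{\kappa(i)}\in\mathbb Q[q][[x_1,x_2,\dots]]$$ be its chromatic quasisymmetric function, where $\kappa$ ranges over all proper colorings $\kappa:[n]\to\{1,2,\dots\}$ of $\mathrm{inc}(P)$ and $\mathrm{asc}(\kappa)$ is the number of edges $\{i,j\}$ of $\mathrm{inc}(P)$ with $i<j$ and $\kappa(i)<\kappa(j)$. Then there are unique polynomials $c_\lambda(q)\in\mathbb Q[q]$, indexed by the partitions $\lambda$ of $n$, such that $X_P(\mathbf x,q)=\sum_{\lambda\vdash n}c_\lambda(q)\,e_\lambda(\mathbf x)$, where $e_\lambda=e_{\lambda_1}e_{\lambda_2}\cdots$ are the elementary symmetric functions. Let $n_e$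 and $n_o$ be the numbers of connected components of $\mathrm{inc}(P)$ with an even and with an odd number of vertices, respectively. Then $(n-2n_e-n_o)/2$ is a nonnegative integer, and for every partition $\lambda$ of $n$ of two-column shape, that is, $\lambda=(2^\ell,1^{k-\ell})$ for some $k\ge\ell\ge0$ (so that the conjugate partition is $\lambda'=(k,\ell)$, where $\ell=0$ is allowed), $$c_\lambda(q)=\begin{cases} q^{(n-2n_e-n_o)/2}(1+q)^{n_e} & \text{if } \mathrm{inc}(P)\text{ is triangle-free and } \lambda'=\left(\tfrac{n+n_o}{2},\tfrac{n-n_o}{2}\right),\\ 0 & \text{otherwise.}\end{cases}$$ In particular, for every partition $\lambda$ of two-column shape the polynomial $c_\lambda(q)$ is unimodal: its sequence of coefficients weakly increases up to some index and weakly decreases from there on. -/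

import Mathlib

open scoped Polynomial

/-- The data of a natural unit interval order on `[n]`, with `[n]` realised as `Fin n`:
a weakly increasing sequence `m` in `[n]` with `i ≤ m i` for every `i`. -/
structure NaturalUnitIntervalOrder (n : ℕ) where
  m : Fin n → Fin n
  monotone_m : Monotone m
  le_m : ∀ i, i ≤ m i

namespace NaturalUnitIntervalOrder

variable {n : ℕ}

/-- The poset on `[n]` in which `i <_P j` if and only if `m i < j`. -/
abbrev poset (P : NaturalUnitIntervalOrder n) : PartialOrder (Fin n) where
  le i j := i = j ∨ P.m i < j
  lt i j := P.m i < j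
  le_refl i := Or.inl rfl
  le_trans i j k hij hjk := by
    rcases hij with rfl | hij
    · exact hjk
    · rcases hjk with rfl | hjk
      · exact Or.inr hij
      · exact Or.inr (hij.trans ((P.le_m j).trans_lt hjk))
  le_antisymm i j hij hji := by
    rcases hij with h | hij
    · exact h
    · rcases hji with h | hji
      · exact h.symm
      · exact absurd (((P.le_m i).trans_lt hij).trans ((P.le_m j).trans_lt hji)) (lt_irrefl i)
  lt_iff_le_not_ge i j := by
    constructor
    · intro h
      have hij : i < j := (P.le_m i).trans_lt h
      refine ⟨Or.inr h, ?_⟩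
      rintro (h' | h')
      · exact hij.ne h'.symm
      · exact absurd (hij.trans ((P.le_m j).trans_lt h')) (lt_irrefl i)
    · rintro ⟨h | h, h'⟩
      · exact absurd (Or.inl h.symm) h'
      · exact h

end NaturalUnitIntervalOrder

/-- The incomparability graph of a poset. -/
def incomparabilityGraph {V : Type*} (p : PartialOrder V) : SimpleGraph V where
  Adj a b := ¬ p.le a b ∧ ¬ p.le b a
  symm := ⟨fun _ _ h => ⟨h.2, h.1⟩⟩
  loopless := ⟨fun a h => h.1 (p.le_refl a)⟩

/-- The incomparability graph `inc(P)` of a natural unit interval order. -/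
def NaturalUnitIntervalOrder.inc {n : ℕ} (P : NaturalUnitIntervalOrder n) :
    SimpleGraph (Fin n) :=
  incomparabilityGraph P.poset

section Chromatic

variable {n : ℕ}

/-- The number of ascents of a proper coloring `κ`: edges `{i, j}` with `i < j` and
`κ i < κ j`. -/
noncomputable def ascents (G : SimpleGraph (Fin n)) (κ : G.Coloring ℕ+) : ℕ :=
  Set.ncard {p : Fin n × Fin n | G.Adj p.1 p.2 ∧ p.1 < p.2 ∧ κ p.1 < κ p.2}

/-- The exponent of the monomial `x^κ = ∏ i, x_{κ i}`. -/
noncomputable def colorWeight (G : SimpleGraph (Fin n)) (κ : G.Coloring ℕ+) : ℕ+ →₀ ℕ :=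
  ∑ i, Finsupp.single (κ i) 1

/-- Only finitely many proper colorings contribute to a given monomial. -/
theorem finite_colorings_of_weight (G : SimpleGraph (Fin n)) (d : ℕ+ →₀ ℕ) :
    {κ : G.Coloring ℕ+ | colorWeight G κ = d}.Finite := by
  classical
  have hinj : Function.Injective (fun κ : G.Coloring ℕ+ => (κ : Fin n → ℕ+)) :=
    DFunLike.coe_injective
  refine Set.Finite.of_finite_image (f := fun κ : G.Coloring ℕ+ => (κ : Fin n → ℕ+))
    (Set.Finite.subset (Fintype.piFinset fun _ : Fin n => d.support).finite_toSet ?_)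
    hinj.injOn
  rintro _ ⟨κ, hκ, rfl⟩
  rw [Finset.mem_coe, Fintype.mem_piFinset]
  intro i
  have hκ' : colorWeight G κ = d := hκ
  rw [← hκ', Finsupp.mem_support_iff, colorWeight, Finsupp.finsetSum_apply]
  intro h
  have := (Finset.sum_eq_zero_iff.mp h) i (Finset.mem_univ i)
  simp at this

/-- The chromatic quasisymmetric function `X_G(x, q) = ∑_κ q^{asc κ} x^κ`, summed over all
proper colorings `κ : [n] → {1, 2, …}` of `G`, as a formal power series in `x_1, x_2, …` over
`ℚ[q]`: the coefficient of `x^d` is the sum of `q^{asc κ}` over all `κ` with `x^κ = x^d`. -/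
noncomputable def chromaticQuasisymmetric (G : SimpleGraph (Fin n)) :
    MvPowerSeries ℕ+ ℚ[X] :=
  fun d => ∑ κ ∈ (finite_colorings_of_weight G d).toFinset, Polynomial.X ^ ascents G κ

end Chromatic

open Classical in
/-- The elementary symmetric function `e_k` in `x_1, x_2, …`: the sum of all squarefree
monomials of degree `k`. -/
noncomputable def elemSymm (k : ℕ) : MvPowerSeries ℕ+ ℚ[X] :=
  fun d => if (∀ i, d i ≤ 1) ∧ d.degree = k then 1 else 0

/-- `e_λ = e_{λ_1} e_{λ_2} ⋯`. -/
noncomputable def elemSymmPartition {n : ℕ} (lam : n.Partition) : MvPowerSeries ℕ+ ℚ[X] :=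
  (lam.parts.map elemSymm).prod

/-- `c` is the family of coefficients of an expansion `X_P(x, q) = ∑_{λ ⊢ n} c_λ(q) e_λ(x)`. -/
def IsElementaryExpansion {n : ℕ} (P : NaturalUnitIntervalOrder n)
    (c : n.Partition → ℚ[X]) : Prop :=
  chromaticQuasisymmetric P.inc = ∑ lam : n.Partition, c lam • elemSymmPartition lam

/-- The part `λ'_i` (for `i ≥ 1`) of the conjugate partition: the number of parts of `λ` that
are at least `i`. -/
def conjPart {n : ℕ} (lam : n.Partition) (i : ℕ) : ℕ :=
  (lam.parts.filter (fun a => i ≤ a)).card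

/-- `λ` has two-column shape: `λ = (2^ℓ, 1^{k-ℓ})` for some `k ≥ ℓ ≥ 0`. -/
def IsTwoColumn {n : ℕ} (lam : n.Partition) : Prop :=
  ∃ k l : ℕ, l ≤ k ∧ lam.parts = Multiset.replicate l 2 + Multiset.replicate (k - l) 1

/-- The number of connected components with an even number of vertices. -/
noncomputable def numEvenComponents {V : Type*} (G : SimpleGraph V) : ℕ :=
  Set.ncard {C : G.ConnectedComponent | Even C.supp.ncard}

/-- The number of connected components with an odd number of vertices. -/
noncomputable def numOddComponents {V : Type*} (G : SimpleGraph V) : ℕ :=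
  Set.ncard {C : G.ConnectedComponent | Odd C.supp.ncard}

/-- The coefficient sequence of a polynomial weakly increases up to some index and weakly
decreases from there on. -/
def IsUnimodal (p : ℚ[X]) : Prop :=
  ∃ j : ℕ, (∀ a b, a ≤ b → b ≤ j → p.coeff a ≤ p.coeff b) ∧
    ∀ a b, j ≤ a → a ≤ b → p.coeff b ≤ p.coeff a

/-! Setting `x_3 = x_4 = ⋯ = 0` kills `e_k` for `k ≥ 3`, hence every `e_λ` with a part above 2,
while `e_1` and `e_2` stay algebraically independent. The coefficients at two-column shapes can
therefore be read off from `X_P(x_1, x_2)`, which enumerates proper colorings with two colors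
(`killCompl_sum`, `coeff_partPoly`).

If `inc(P)` has a triangle there are no such colorings and the restriction is 0. Otherwise edges
join consecutive integers only, so each component is a path with exactly two colorings. A path on
`2m` vertices contributes `q^(m-1) (1+q) e_2^m`, a path on `2m+1` vertices `q^m e_2^m e_1`
(`sum_monomial_compWeight`). The product over the components is a single monomial in `e_1, e_2`
(`killCompl_chromaticQuasisymmetric`, `prod_compPoly_eq`), so at most one two-column coefficient is
nonzero. It is a power of `q` times a power of `1 + q`, hence unimodal.

That an expansion exists needs `X_P` to be symmetric. For adjacent colors `a, b` the vertices
colored `a` or `b` induce a disjoint union of paths with alternating colors. Exchanging `a` and `b`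
on the paths of odd size is an involution that exchanges the two color counts, since even paths are
balanced (`colorWeight_flipColoring`), and that preserves ascents, since an odd path has equally
many under both colorings (`ascents_flipColoring`). The fundamental theorem on symmetric polynomials
in `n` variables then gives existence and uniqueness, because a symmetric series of degree `n` is
determined by its restriction to `n` variables. -/

/-! ### Elementary symmetric functions restricted to finitely many variables -/

section ElementaryBasis

open MvPolynomial

/-- The embedding of `Fin N` as the first `N` positive integers. -/
def finPNat (N : ℕ) : Fin N ↪ ℕ+ where
  toFun i := Nat.succPNat i
  inj' i j h := by simpa [Fin.ext_iff] using h

theorem finPNat_coe (N : ℕ) (i : Fin N) : (finPNat N i : ℕ) = i + 1 := rfl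

theorem coeff_esymm {N : ℕ} (k : ℕ) (d : Fin N →₀ ℕ) :
    MvPolynomial.coeff d (esymm (Fin N) ℚ[X] k) =
      if (∀ i, d i ≤ 1) ∧ d.degree = k then 1 else 0 := by
  classical
  -- A squarefree exponent is the indicator of its support, so at most one subset of the variables
  -- contributes to a given monomial.
  have key : ∀ s : Finset (Fin N), ((∑ i ∈ s, Finsupp.single i 1 : Fin N →₀ ℕ) = d ↔
      (∀ i, d i ≤ 1) ∧ s = d.support) := by
    intro s
    have h1 : ∀ j, (∑ i ∈ s, Finsupp.single i 1 : Fin N →₀ ℕ) j = if j ∈ s then 1 else 0 := by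
      intro j
      simp [Finsupp.finsetSum_apply, Finsupp.single_apply]
    constructor
    · rintro rfl
      refine ⟨fun i => ?_, ?_⟩
      · rw [h1]; split_ifs <;> simp
      · ext j
        rw [Finsupp.mem_support_iff, h1]; simp
    · rintro ⟨hd, rfl⟩
      ext j
      rw [h1]
      have := hd j
      by_cases h : d j = 0
      · simp [h]
      · simp [h]; omega
  have hdeg : (∀ i, d i ≤ 1) → d.degree = d.support.card := by
    intro hd
    rw [Finsupp.degree_apply, Finset.card_eq_sum_ones]
    refine Finset.sum_congr rfl fun i hi => ?_
    have := hd i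
    have := Finsupp.mem_support_iff.mp hi
    omega
  rw [esymm_eq_sum_monomial, coeff_sum]
  simp_rw [coeff_monomial, key]
  by_cases hd : ∀ i, d i ≤ 1
  · simp [hd, hdeg hd, Finset.mem_powersetCard]
  · simp [hd]

theorem embDomain_le_one_iff {σ τ : Type*} (e : σ ↪ τ) (d : σ →₀ ℕ) :
    (∀ i, Finsupp.embDomain e d i ≤ 1) ↔ ∀ i, d i ≤ 1 := by
  constructor
  · intro h i
    simpa using h (e i)
  · intro h i
    by_cases hi : i ∈ Set.range e
    · obtain ⟨j, rfl⟩ := hi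
      simpa using h j
    · rw [Finsupp.embDomain_of_notMem_range _ _ _ hi]; simp

theorem degree_embDomain {σ τ : Type*} (e : σ ↪ τ) (d : σ →₀ ℕ) :
    (Finsupp.embDomain e d).degree = d.degree := by
  simp [Finsupp.degree_apply, Finsupp.support_embDomain]

theorem killCompl_elemSymm (N k : ℕ) :
    MvPowerSeries.killCompl (finPNat N) (elemSymm k) =
      (esymm (Fin N) ℚ[X] k : MvPowerSeries (Fin N) ℚ[X]) := by
  classical
  ext1 d
  rw [MvPowerSeries.coeff_killCompl, MvPolynomial.coeff_coe, coeff_esymm]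
  change (if _ then _ else _) = _
  simp only [embDomain_le_one_iff, degree_embDomain]

/-- The multiplicities of the parts `1, …, N` of a partition. -/
noncomputable def expVec (N : ℕ) {n : ℕ} (lam : n.Partition) : Fin N →₀ ℕ :=
  Finsupp.equivFunOnFinite.symm fun i => lam.parts.count (i + 1 : ℕ)

@[simp] theorem expVec_apply (N : ℕ) {n : ℕ} (lam : n.Partition) (i : Fin N) :
    expVec N lam i = lam.parts.count (i + 1 : ℕ) := rfl

theorem prod_map_eq_prod_pow_count {M : Type*} [CommMonoid M] (f : ℕ → M) (N : ℕ)
    (s : Multiset ℕ) (hs : ∀ p ∈ s, 0 < p ∧ p ≤ N) :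
    (s.map f).prod = ∏ i : Fin N, f (i + 1) ^ s.count (i + 1 : ℕ) := by
  induction s using Multiset.induction_on with
  | empty => simp
  | cons a s ih =>
    obtain ⟨h0, hN⟩ := hs a (Multiset.mem_cons_self a s)
    rw [Multiset.map_cons, Multiset.prod_cons,
      ih fun p hp => hs p (Multiset.mem_cons_of_mem hp)]
    simp_rw [Multiset.count_cons, pow_add]
    rw [Finset.prod_mul_distrib, mul_comm]
    congr 1
    rw [Finset.prod_eq_single (⟨a - 1, by omega⟩ : Fin N)]
    · simp [Nat.sub_add_cancel h0]
    · intro i _ hi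
      have : ¬ ((i : ℕ) + 1 = a) := by
        intro h
        apply hi
        ext
        simp; omega
      simp [this]
    · simp

theorem expVec_weight (N : ℕ) {n : ℕ} (lam : n.Partition) (h : ∀ p ∈ lam.parts, p ≤ N) :
    ∑ i : Fin N, expVec N lam i * (i + 1 : ℕ) = n := by
  -- In `Multiplicative ℕ` the product formula becomes a formula for the sum of the parts.
  have := prod_map_eq_prod_pow_count (fun k => Multiplicative.ofAdd k) N lam.parts
    fun p hp => ⟨lam.parts_pos hp, h p hp⟩
  have h2 := congrArg Multiplicative.toAdd this
  rw [toAdd_prod] at h2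
  simp only [toAdd_pow, toAdd_ofAdd, smul_eq_mul] at h2
  simp only [expVec_apply]
  rw [← h2]
  have h3 : ∀ s : Multiset ℕ,
      Multiplicative.toAdd (s.map fun k => Multiplicative.ofAdd k).prod = s.sum := by
    intro s
    induction s using Multiset.induction_on with
    | empty => simp
    | cons a s ih => simp [ih]
  rw [h3, lam.parts_sum]

/-- The bounds are needed because `expVec N` does not see parts larger than `N`. -/
theorem expVec_injective (N : ℕ) {n : ℕ} {lam mu : n.Partition}
    (hl : ∀ p ∈ lam.parts, p ≤ N) (hm : ∀ p ∈ mu.parts, p ≤ N)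
    (h : expVec N lam = expVec N mu) : lam = mu := by
  apply Nat.Partition.ext
  ext a
  by_cases ha : 0 < a ∧ a ≤ N
  · have := DFunLike.congr_fun h (⟨a - 1, by omega⟩ : Fin N)
    simpa [Nat.sub_add_cancel ha.1] using this
  · rw [Multiset.count_eq_zero_of_notMem, Multiset.count_eq_zero_of_notMem]
    · exact fun h => ha ⟨mu.parts_pos h, hm a h⟩
    · exact fun h => ha ⟨lam.parts_pos h, hl a h⟩

theorem exists_expVec_eq {N n : ℕ} (t : Fin N →₀ ℕ) (ht : ∑ i : Fin N, t i * (i + 1 : ℕ) = n) :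
    ∃ lam : n.Partition, (∀ p ∈ lam.parts, p ≤ N) ∧ expVec N lam = t := by
  refine ⟨⟨∑ i : Fin N, Multiset.replicate (t i) (i + 1 : ℕ), ?_, ?_⟩, ?_, ?_⟩
  · intro p hp
    obtain ⟨i, _, hi⟩ := Multiset.mem_sum.mp hp
    rw [Multiset.eq_of_mem_replicate hi]
    omega
  · rw [Multiset.sum_sum]
    simpa using ht
  · intro p hp
    change p ∈ ∑ i : Fin N, Multiset.replicate (t i) (i + 1 : ℕ) at hp
    obtain ⟨i, _, hi⟩ := Multiset.mem_sum.mp hp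
    rw [Multiset.eq_of_mem_replicate hi]
    omega
  · ext i
    simp [Multiset.count_sum', Multiset.count_replicate, ← Fin.ext_iff]

/-- In `N` variables `e_k` vanishes for `k > N`. For `N = 2` the survivors are exactly the
two-column shapes. -/
theorem esymmPart_eq (N : ℕ) {n : ℕ} (lam : n.Partition) :
    esymmPart (Fin N) ℚ[X] lam =
      if ∀ p ∈ lam.parts, p ≤ N then
        ((esymmAlgHom (Fin N) ℚ[X] N (monomial (expVec N lam) 1) :
          symmetricSubalgebra (Fin N) ℚ[X]) : MvPolynomial (Fin N) ℚ[X]) else 0 := by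
  split_ifs with h
  · rw [esymmPart, prod_map_eq_prod_pow_count _ N _ fun p hp => ⟨lam.parts_pos hp, h p hp⟩,
      esymmAlgHom_apply, aeval_monomial, map_one, one_mul, Finsupp.prod_fintype]
    · rfl
    · simp
  · push Not at h
    obtain ⟨p, hp, hN⟩ := h
    rw [esymmPart]
    apply Multiset.prod_eq_zero
    rw [Multiset.mem_map]
    refine ⟨p, hp, ?_⟩
    rw [esymm, Finset.powersetCard_eq_empty.mpr (by simpa using hN), Finset.sum_empty]

theorem killCompl_elemSymmPartition (N : ℕ) {n : ℕ} (lam : n.Partition) :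
    MvPowerSeries.killCompl (finPNat N) (elemSymmPartition lam) =
      (esymmPart (Fin N) ℚ[X] lam : MvPowerSeries (Fin N) ℚ[X]) := by
  rw [elemSymmPartition, esymmPart, map_multiset_prod, Multiset.map_map]
  have h : ∀ q : MvPolynomial (Fin N) ℚ[X],
      (q : MvPowerSeries (Fin N) ℚ[X]) = coeToMvPowerSeries.ringHom q := fun _ => rfl
  rw [h, map_multiset_prod, Multiset.map_map]
  congr 1
  refine Multiset.map_congr rfl fun k _ => ?_
  exact killCompl_elemSymm N k

open Classical in
/-- The polynomial in the variables `e_1, …, e_N` to which `∑ c_λ e_λ` restricts. -/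
noncomputable def partPoly (N : ℕ) {n : ℕ} (c : n.Partition → ℚ[X]) : MvPolynomial (Fin N) ℚ[X] :=
  ∑ lam : n.Partition, if ∀ p ∈ lam.parts, p ≤ N then monomial (expVec N lam) (c lam) else 0

theorem coeff_partPoly (N : ℕ) {n : ℕ} (c : n.Partition → ℚ[X]) (lam : n.Partition)
    (h : ∀ p ∈ lam.parts, p ≤ N) : MvPolynomial.coeff (expVec N lam) (partPoly N c) = c lam := by
  classical
  rw [partPoly, coeff_sum, Finset.sum_eq_single lam]
  · rw [if_pos h, coeff_monomial, if_pos rfl]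
  · intro mu _ hmu
    split_ifs with hm
    · rw [coeff_monomial, if_neg]
      exact fun he => hmu (expVec_injective N hm h he)
    · simp
  · simp

/-- Since `esymmAlgHom` is injective here, knowing the restriction of an expansion to `N` variables
amounts to knowing `partPoly N c`. This is applied with `N = n` for existence and uniqueness, and
with `N = 2` for the formula. -/
theorem killCompl_sum (N : ℕ) {n : ℕ} (c : n.Partition → ℚ[X]) :
    MvPowerSeries.killCompl (finPNat N) (∑ lam : n.Partition, c lam • elemSymmPartition lam) =
      (((esymmAlgHom (Fin N) ℚ[X] N (partPoly N c) : symmetricSubalgebra (Fin N) ℚ[X]) :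
        MvPolynomial (Fin N) ℚ[X]) : MvPowerSeries (Fin N) ℚ[X]) := by
  rw [map_sum, partPoly, map_sum]
  have h : ∀ q : MvPolynomial (Fin N) ℚ[X],
      (q : MvPowerSeries (Fin N) ℚ[X]) = coeToMvPowerSeries.ringHom q := fun _ => rfl
  rw [AddSubmonoidClass.coe_finsetSum, h, map_sum]
  refine Finset.sum_congr rfl fun lam _ => ?_
  rw [map_smul, killCompl_elemSymmPartition, esymmPart_eq]
  split_ifs with hl
  · rw [← mul_one (c lam), ← smul_eq_mul, ← smul_monomial, map_smul, ← h]
    ext1 d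
    simp [MvPolynomial.coeff_coe]
  · simp

end ElementaryBasis

/-! ### Symmetric series of degree `n` and their expansions in the `e_λ` -/

section SymmetricSeries

open MvPolynomial

/-- A power series in `x_1, x_2, …` is symmetric if it is invariant under all transpositions of
the variables. -/
def IsSymmetricSeries (F : MvPowerSeries ℕ+ ℚ[X]) : Prop :=
  ∀ a b : ℕ+, MvPowerSeries.killCompl (Equiv.swap a b).toEmbedding F = F

theorem isSymmetricSeries_elemSymm (k : ℕ) : IsSymmetricSeries (elemSymm k) := by
  classical
  intro a b
  ext1 d
  rw [MvPowerSeries.coeff_killCompl]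
  change (if _ then _ else _) = (if _ then _ else _)
  simp only [embDomain_le_one_iff, degree_embDomain]

theorem isSymmetricSeries_elemSymmPartition {n : ℕ} (lam : n.Partition) :
    IsSymmetricSeries (elemSymmPartition lam) := by
  intro a b
  rw [elemSymmPartition, map_multiset_prod, Multiset.map_map]
  congr 1
  exact Multiset.map_congr rfl fun k _ => isSymmetricSeries_elemSymm k a b

theorem isSymmetricSeries_sum {n : ℕ} (c : n.Partition → ℚ[X]) :
    IsSymmetricSeries (∑ lam : n.Partition, c lam • elemSymmPartition lam) := by
  intro a b
  rw [map_sum]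
  refine Finset.sum_congr rfl fun lam _ => ?_
  rw [map_smul, isSymmetricSeries_elemSymmPartition]

theorem IsSymmetricSeries.coeff_embDomain {F : MvPowerSeries ℕ+ ℚ[X]} (hF : IsSymmetricSeries F)
    (a b : ℕ+) (d : ℕ+ →₀ ℕ) :
    MvPowerSeries.coeff (Finsupp.embDomain (Equiv.swap a b).toEmbedding d) F =
      MvPowerSeries.coeff d F := by
  rw [← MvPowerSeries.coeff_killCompl, hF a b]

theorem finPNat_range (N : ℕ) : Set.range (finPNat N) = {a : ℕ+ | (a : ℕ) ≤ N} := by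
  ext a
  simp only [Set.mem_range, Set.mem_ofPred_eq]
  constructor
  · rintro ⟨i, rfl⟩
    rw [finPNat_coe]; omega
  · intro h
    have := a.pos
    refine ⟨⟨a - 1, by omega⟩, ?_⟩
    apply PNat.eq
    rw [finPNat_coe]
    simp; omega

/-- A symmetric series is determined in degree `n` by its restriction to the first `n`
variables. -/
theorem IsSymmetricSeries.coeff_eq_of_killCompl_eq {F G : MvPowerSeries ℕ+ ℚ[X]}
    (hF : IsSymmetricSeries F) (hG : IsSymmetricSeries G) (n : ℕ)
    (h : MvPowerSeries.killCompl (finPNat n) F = MvPowerSeries.killCompl (finPNat n) G)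
    (d : ℕ+ →₀ ℕ) (hd : d.degree = n) :
    MvPowerSeries.coeff d F = MvPowerSeries.coeff d G := by
  classical
  -- Induction on the number of variables of index above `n` in the monomial; a transposition trades
  -- one of them for an unused variable of index at most `n`.
  induction hk : (d.support.filter fun a : ℕ+ => n < (a : ℕ)).card using
    Nat.strong_induction_on generalizing d with
  | _ k ih =>
    by_cases hne : (d.support.filter fun a : ℕ+ => n < (a : ℕ)).Nonempty
    · obtain ⟨x, hx⟩ := hne
      rw [Finset.mem_filter] at hx
      -- Pigeonhole: if all of the first `n` variables occurred besides `x`, the support would have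
      -- more than `n` elements, exceeding the degree.
      obtain ⟨y, hyn, hyd⟩ : ∃ y : ℕ+, (y : ℕ) ≤ n ∧ y ∉ d.support := by
        by_contra! hcon
        have hsub : insert x (Finset.univ.map (finPNat n)) ⊆ d.support := by
          intro z hz
          rcases Finset.mem_insert.mp hz with rfl | hz
          · exact hx.1
          · obtain ⟨i, _, rfl⟩ := Finset.mem_map.mp hz
            refine hcon _ ?_
            rw [finPNat_coe]; omega
        have hcard := Finset.card_le_card hsub
        rw [Finset.card_insert_of_notMem, Finset.card_map, Finset.card_univ, Fintype.card_fin]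
          at hcard
        · have : d.support.card ≤ d.degree := by
            rw [Finsupp.degree_apply, Finset.card_eq_sum_ones]
            exact Finset.sum_le_sum fun i hi =>
              Nat.one_le_iff_ne_zero.mpr (Finsupp.mem_support_iff.mp hi)
          omega
        · intro hz
          obtain ⟨i, _, hi⟩ := Finset.mem_map.mp hz
          have := finPNat_coe n i
          rw [hi] at this
          omega
      rw [← hF.coeff_embDomain x y, ← hG.coeff_embDomain x y]
      refine ih _ ?_ _ (by rw [degree_embDomain, hd]) rfl
      rw [← hk]
      apply Finset.card_lt_card
      rw [Finset.ssubset_iff_of_subset]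
      · refine ⟨x, Finset.mem_filter.mpr hx, ?_⟩
        intro hx'
        rw [Finset.mem_filter, Finsupp.support_embDomain, Finset.mem_map] at hx'
        obtain ⟨⟨z, hz, hzx⟩, _⟩ := hx'
        have : z = y := by
          apply (Equiv.swap x y).injective
          simpa using hzx
        exact hyd (this ▸ hz)
      · intro w hw
        rw [Finset.mem_filter, Finsupp.support_embDomain, Finset.mem_map] at hw
        obtain ⟨⟨z, hz, hzw⟩, hwn⟩ := hw
        rw [Finset.mem_filter]
        refine ⟨?_, hwn⟩
        change Equiv.swap x y z = w at hzw
        by_cases hzx : z = x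
        · subst hzx
          rw [Equiv.swap_apply_left] at hzw
          subst hzw; omega
        · by_cases hzy : z = y
          · exact absurd (hzy ▸ hz) hyd
          · rw [Equiv.swap_apply_of_ne_of_ne hzx hzy] at hzw
            exact hzw ▸ hz
    · have hsub : (d.support : Set ℕ+) ⊆ Set.range (finPNat n) := by
        intro a ha
        rw [finPNat_range]
        by_contra hcon
        exact hne ⟨a, Finset.mem_filter.mpr ⟨ha, not_le.mp hcon⟩⟩
      rw [← Finsupp.embDomain_comapDomain hsub, ← MvPowerSeries.coeff_killCompl, h,
        MvPowerSeries.coeff_killCompl]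

theorem isHomogeneous_esymm {N : ℕ} (k : ℕ) : (esymm (Fin N) ℚ[X] k).IsHomogeneous k := by
  intro d hd
  rw [coeff_esymm] at hd
  by_contra hne
  apply hd
  rw [if_neg]
  rintro ⟨_, h⟩
  rw [Finsupp.degree_eq_weight_one] at h
  exact hne h

theorem isHomogeneous_esymmAlgHom_monomial {N : ℕ} (t : Fin N →₀ ℕ) (r : ℚ[X]) :
    ((esymmAlgHom (Fin N) ℚ[X] N (monomial t r) : symmetricSubalgebra (Fin N) ℚ[X]) :
      MvPolynomial (Fin N) ℚ[X]).IsHomogeneous (∑ i : Fin N, t i * (i + 1 : ℕ)) := by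
  rw [esymmAlgHom_apply, aeval_monomial, Finsupp.prod_fintype _ _ (by simp)]
  apply IsHomogeneous.C_mul
  apply IsHomogeneous.prod
  intro i _
  rw [mul_comm]
  exact (isHomogeneous_esymm _).pow _

/-- The fundamental theorem writes `p` as a polynomial `g` in the `e_i`; its monomials of weighted
degree `n` are indexed by the partitions of `n`. -/
theorem exists_partPoly_eq {n : ℕ} (p : MvPolynomial (Fin n) ℚ[X]) (hp : p.IsSymmetric)
    (hn : p.IsHomogeneous n) : ∃ c : n.Partition → ℚ[X],
      ((esymmAlgHom (Fin n) ℚ[X] n (partPoly n c) : symmetricSubalgebra (Fin n) ℚ[X]) :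
        MvPolynomial (Fin n) ℚ[X]) = p := by
  classical
  obtain ⟨g, hg⟩ := (esymmAlgHom_fin_bijective ℚ[X] n).2 ⟨p, hp⟩
  have hle : ∀ lam : n.Partition, ∀ q ∈ lam.parts, q ≤ n := fun lam q hq => by
    rw [← lam.parts_sum]
    exact Multiset.le_sum_of_mem hq
  set φ : (Fin n →₀ ℕ) → MvPolynomial (Fin n) ℚ[X] := fun t =>
    ((esymmAlgHom (Fin n) ℚ[X] n (monomial t (coeff t g)) : symmetricSubalgebra (Fin n) ℚ[X]) :
        MvPolynomial (Fin n) ℚ[X]) with hφ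
  have hp2 : p = ∑ t ∈ g.support, φ t := by
    have : p = ((esymmAlgHom (Fin n) ℚ[X] n g : symmetricSubalgebra (Fin n) ℚ[X]) :
        MvPolynomial (Fin n) ℚ[X]) := by rw [hg]
    rw [this]
    conv_lhs => rw [g.as_sum]
    rw [map_sum, AddSubmonoidClass.coe_finsetSum]
  refine ⟨fun lam => coeff (expVec n lam) g, ?_⟩
  have h1 : ((esymmAlgHom (Fin n) ℚ[X] n (partPoly n fun lam : n.Partition =>
      coeff (expVec n lam) g) : symmetricSubalgebra (Fin n) ℚ[X]) :
        MvPolynomial (Fin n) ℚ[X]) = ∑ lam : n.Partition, φ (expVec n lam) := by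
    rw [partPoly, map_sum, AddSubmonoidClass.coe_finsetSum]
    refine Finset.sum_congr rfl fun lam _ => ?_
    rw [if_pos (hle lam)]
  have h2 : ∑ lam : n.Partition, φ (expVec n lam) =
      ∑ t ∈ Finset.univ.image fun lam : n.Partition => expVec n lam, φ t := by
    rw [Finset.sum_image]
    intro lam _ mu _ h
    exact expVec_injective n (hle lam) (hle mu) h
  -- Taking the homogeneous component of degree `n` discards all other monomials of `g`, so `g`
  -- itself need not be shown weighted homogeneous.
  have h3 : p = ∑ t ∈ g.support.filter fun t => ∑ i : Fin n, t i * (i + 1 : ℕ) = n, φ t := by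
    have h4 : homogeneousComponent n p = p := homogeneousComponent_eq_self hn
    rw [← h4]
    conv_lhs => rw [hp2]
    rw [map_sum, Finset.sum_filter]
    refine Finset.sum_congr rfl fun t _ => ?_
    rw [homogeneousComponent_of_mem (isHomogeneous_esymmAlgHom_monomial t (coeff t g))]
    simp only [eq_comm, hφ]
  rw [h1, h2, h3]
  symm
  apply Finset.sum_subset
  · intro t ht
    rw [Finset.mem_filter] at ht
    obtain ⟨lam, _, rfl⟩ := exists_expVec_eq t ht.2
    exact Finset.mem_image_of_mem _ (Finset.mem_univ _)
  · intro t ht hnt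
    obtain ⟨lam, _, rfl⟩ := Finset.mem_image.mp ht
    have : coeff (expVec n lam) g = 0 := by
      by_contra hne
      exact hnt (Finset.mem_filter.mpr ⟨mem_support_iff.mpr hne, expVec_weight n lam (hle lam)⟩)
    simp only [hφ, this, map_zero, ZeroMemClass.coe_zero]

theorem coeff_prod_elemSymm (s : Multiset ℕ) (d : ℕ+ →₀ ℕ) (h : d.degree ≠ s.sum) :
    MvPowerSeries.coeff d (s.map elemSymm).prod = 0 := by
  classical
  induction s using Multiset.induction_on generalizing d with
  | empty =>
    rw [Multiset.map_zero, Multiset.prod_zero, MvPowerSeries.coeff_one, if_neg]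
    rintro rfl
    simp at h
  | cons a s ih =>
    rw [Multiset.map_cons, Multiset.prod_cons, MvPowerSeries.coeff_mul]
    refine Finset.sum_eq_zero fun x hx => ?_
    rw [Finset.HasAntidiagonal.mem_antidiagonal] at hx
    by_cases h2 : x.2.degree = s.sum
    · have h1 : MvPowerSeries.coeff x.1 (elemSymm a) = 0 := by
        change (if _ then _ else _) = _
        rw [if_neg]
        rintro ⟨_, h1⟩
        apply h
        rw [← hx, map_add, h1, h2, Multiset.sum_cons]
      rw [h1, zero_mul]
    · rw [ih _ h2, mul_zero]

/-- Every symmetric series that is homogeneous of degree `n` is a combination of the `e_λ`. -/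
theorem IsSymmetricSeries.exists_expansion {F : MvPowerSeries ℕ+ ℚ[X]} (hF : IsSymmetricSeries F)
    (n : ℕ) (hn : ∀ d : ℕ+ →₀ ℕ, d.degree ≠ n → MvPowerSeries.coeff d F = 0) :
    ∃ c : n.Partition → ℚ[X], F = ∑ lam : n.Partition, c lam • elemSymmPartition lam := by
  classical
  -- The restriction to `n` variables is a genuine polynomial, since only finitely many exponents
  -- have degree `n`.
  set p : MvPolynomial (Fin n) ℚ[X] := ∑ d ∈ Finset.finsuppAntidiag Finset.univ n,
    monomial d (MvPowerSeries.coeff (Finsupp.embDomain (finPNat n) d) F) with hp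
  have hcoeff : ∀ d, coeff d p = MvPowerSeries.coeff (Finsupp.embDomain (finPNat n) d) F := by
    intro d
    rw [hp, coeff_sum]
    simp_rw [coeff_monomial]
    rw [Finset.sum_ite_eq']
    split_ifs with h
    · rfl
    · symm
      apply hn
      rw [degree_embDomain]
      intro hd
      apply h
      rw [Finset.mem_finsuppAntidiag]
      exact ⟨(Finsupp.degree_eq_sum d).symm.trans hd, Finset.subset_univ _⟩
  have hkill : MvPowerSeries.killCompl (finPNat n) F = (p : MvPowerSeries (Fin n) ℚ[X]) := by
    ext1 d
    rw [MvPowerSeries.coeff_killCompl, MvPolynomial.coeff_coe, hcoeff]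
  have hhom : p.IsHomogeneous n := by
    intro d hd
    rw [hcoeff] at hd
    by_contra hne
    apply hd
    apply hn
    rw [degree_embDomain, Finsupp.degree_eq_weight_one]
    exact hne
  have hsymm : p.IsSymmetric := by
    intro e
    induction e using Equiv.Perm.swap_induction_on with
    | one => exact rename_id_apply p
    | swap_mul f x y _ ih =>
      have hswap : rename (Equiv.swap x y) p = p := by
        refine MvPolynomial.ext _ _ fun d => ?_
        have hd : d = (d.mapDomain (Equiv.swap x y)).mapDomain (Equiv.swap x y) := by
          rw [← Finsupp.mapDomain_comp]
          conv_lhs => rw [← Finsupp.mapDomain_id (v := d)]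
          congr 1
          ext z
          simp
        have h1 := coeff_rename_mapDomain (Equiv.swap x y) (Equiv.injective _) p
          (d.mapDomain (Equiv.swap x y))
        rw [← hd] at h1
        rw [h1, hcoeff, hcoeff, Finsupp.embDomain_eq_mapDomain, ← Finsupp.mapDomain_comp,
          ← Function.Injective.swap_comp (finPNat n).injective, Finsupp.mapDomain_comp,
          ← Finsupp.embDomain_eq_mapDomain (finPNat n)]
        have := hF.coeff_embDomain (finPNat n x) (finPNat n y) (Finsupp.embDomain (finPNat n) d)
        rw [Finsupp.embDomain_eq_mapDomain] at this
        exact this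
      have : (⇑(Equiv.swap x y * f) : Fin n → Fin n) = Equiv.swap x y ∘ f := rfl
      rw [this, ← rename_rename, ih, hswap]
  obtain ⟨c, hc⟩ := exists_partPoly_eq p hsymm hhom
  refine ⟨c, ?_⟩
  ext1 d
  by_cases hd : d.degree = n
  · refine hF.coeff_eq_of_killCompl_eq (isSymmetricSeries_sum c) n ?_ d hd
    rw [hkill, killCompl_sum, hc]
  · rw [hn d hd]
    symm
    rw [map_sum]
    refine Finset.sum_eq_zero fun lam _ => ?_
    rw [MvPowerSeries.coeff_smul]
    rw [elemSymmPartition, coeff_prod_elemSymm _ d (by rwa [lam.parts_sum]), mul_zero]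

/-- The `e_λ` are linearly independent. -/
theorem expansion_unique {n : ℕ} {c c' : n.Partition → ℚ[X]}
    (h : ∑ lam : n.Partition, c lam • elemSymmPartition lam =
      ∑ lam : n.Partition, c' lam • elemSymmPartition lam) : c = c' := by
  -- Parts of a partition of `n` are at most `n`, so restricting to `n` variables loses no
  -- coefficient.
  have h1 := congrArg (MvPowerSeries.killCompl (finPNat n)) h
  rw [killCompl_sum, killCompl_sum, coe_inj] at h1
  have h2 := (esymmAlgHom_fin_bijective ℚ[X] n).1 (Subtype.ext h1)
  have hle : ∀ lam : n.Partition, ∀ q ∈ lam.parts, q ≤ n := fun lam q hq => by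
    rw [← lam.parts_sum]
    exact Multiset.le_sum_of_mem hq
  funext lam
  rw [← coeff_partPoly n c lam (hle lam), h2, coeff_partPoly n c' lam (hle lam)]

end SymmetricSeries

/-! ### Signed indifference graphs are disjoint unions of monotone paths -/

section Paths

namespace SimpleGraph

section Components

variable {V : Type*} [Fintype V] {H : SimpleGraph V}

open Classical in
/-- The vertices of a component. -/
noncomputable def compSet (C : H.ConnectedComponent) : Finset V :=
  Finset.univ.filter fun v => H.connectedComponentMk v = C

theorem mem_compSet {C : H.ConnectedComponent} {v : V} :
    v ∈ compSet C ↔ H.connectedComponentMk v = C := by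
  simp [compSet]

theorem compSet_nonempty (C : H.ConnectedComponent) : (compSet C).Nonempty := by
  obtain ⟨v, hv⟩ := C.exists_rep
  exact ⟨v, mem_compSet.mpr hv⟩

theorem card_compSet (C : H.ConnectedComponent) : (compSet C).card = C.supp.ncard := by
  rw [← Set.ncard_coe_finset]
  congr 1
  ext v
  simp [mem_compSet, ConnectedComponent.mem_supp_iff]

theorem compSet_reachable {C : H.ConnectedComponent} {u v : V} (hu : u ∈ compSet C)
    (hv : v ∈ compSet C) : H.Reachable u v := by
  rw [mem_compSet] at hu hv
  exact ConnectedComponent.exact (hu.trans hv.symm)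

theorem mem_compSet_of_reachable {C : H.ConnectedComponent} {u v : V} (hu : u ∈ compSet C)
    (h : H.Reachable u v) : v ∈ compSet C := by
  rw [mem_compSet] at hu ⊢
  rw [← hu]
  exact (ConnectedComponent.sound h).symm

end Components

variable {V : Type*} [LinearOrder V]

/-- Two vertices of a component that lie weakly between the ends of an edge of that component
are adjacent. -/
def IsIndifference (H : SimpleGraph V) : Prop :=
  ∀ x u v y, x ≤ u → u < v → v ≤ y → H.Adj x y → H.Reachable x u → H.Reachable x v → H.Adj u v

/-- A function with values `±1` that changes sign along every edge. -/
structure IsSigning (H : SimpleGraph V) (f : V → ℤ) : Prop where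
  sign : ∀ v, f v = 1 ∨ f v = -1
  adj : ∀ u v, H.Adj u v → f v = -f u

variable {H : SimpleGraph V}

/-- A walk from `u` to `v` must leave the vertices `≤ u` along some edge. That edge ends at `v` or
beyond, so it spans both `u` and `v`, and the indifference property applies. -/
theorem IsIndifference.adj_of_consecutive (hH : H.IsIndifference) {u v : V} (huv : u < v)
    (hr : H.Reachable u v) (hc : ∀ w, H.Reachable u w → u < w → v ≤ w) : H.Adj u v := by
  obtain ⟨p⟩ := hr
  obtain ⟨d, hd, h1, h2⟩ := p.exists_boundary_dart (Set.Iic u) (le_refl u) (not_le.mpr huv)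
  have hru : H.Reachable u d.fst := by
    classical
    exact ⟨p.takeUntil d.fst (p.dart_fst_mem_support_of_mem_darts hd)⟩
  have h3 : v ≤ d.snd := hc _ (hru.trans d.adj.reachable) (not_le.mp h2)
  exact hH d.fst u v d.snd h1 huv h3 d.adj hru.symm (hru.symm.trans ⟨p⟩)

variable [Fintype V]

/-- The least vertex of a component. -/
noncomputable def compMin (C : H.ConnectedComponent) : V := (compSet C).min' (compSet_nonempty C)

theorem compMin_mem (C : H.ConnectedComponent) : compMin C ∈ compSet C := Finset.min'_mem _ _

open Classical in
/-- The edges of a component, as increasing pairs. -/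
noncomputable def compEdges (C : H.ConnectedComponent) : Finset (V × V) :=
  Finset.univ.filter fun p => (H.Adj p.1 p.2 ∧ p.1 < p.2) ∧ p.1 ∈ compSet C

theorem mem_compEdges {C : H.ConnectedComponent} {p : V × V} :
    p ∈ compEdges C ↔ (H.Adj p.1 p.2 ∧ p.1 < p.2) ∧ p.1 ∈ compSet C := by
  simp [compEdges]

variable {f : V → ℤ}

/-- The component is a path traversed in increasing order: every vertex except the largest is the
lower end of exactly one edge. -/
theorem IsIndifference.sum_compEdges (hH : H.IsIndifference) (hf : H.IsSigning f)
    (C : H.ConnectedComponent) (g : V → ℤ) :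
    ∑ p ∈ compEdges C, g p.1 =
      ∑ x ∈ (compSet C).erase ((compSet C).max' (compSet_nonempty C)), g x := by
  classical
  refine Finset.sum_bij (fun p _ => p.1) ?_ ?_ ?_ fun _ _ => rfl
  · intro p hp
    rw [mem_compEdges] at hp
    refine Finset.mem_erase.mpr ⟨?_, hp.2⟩
    have h2 : p.2 ∈ compSet C := mem_compSet_of_reachable hp.2 hp.1.1.reachable
    exact (hp.1.2.trans_le (Finset.le_max' _ _ h2)).ne
  · have key : ∀ x y z, H.Adj x y → H.Adj x z → x < y → y < z → False := by
      intro x y z hxy hxz h1 h2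
      have h3 := hf.adj _ _ (hH x y z z h1.le h2 le_rfl hxz hxy.reachable hxz.reachable)
      have h4 := hf.adj _ _ hxy
      have h5 := hf.adj _ _ hxz
      rcases hf.sign x with h | h <;> omega
    rintro ⟨x, y⟩ hp ⟨x', z⟩ hq h
    rw [mem_compEdges] at hp hq
    simp only at h hp hq
    subst h
    rcases lt_trichotomy y z with h | rfl | h
    · exact (key _ _ _ hp.1.1 hq.1.1 hp.1.2 h).elim
    · rfl
    · exact (key _ _ _ hq.1.1 hp.1.1 hq.1.2 h).elim
  · intro x hx
    rw [Finset.mem_erase] at hx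
    have hne : ((compSet C).filter fun y => x < y).Nonempty :=
      ⟨_, Finset.mem_filter.mpr ⟨Finset.max'_mem _ (compSet_nonempty C),
        lt_of_le_of_ne (Finset.le_max' _ _ hx.2) hx.1⟩⟩
    have hy := Finset.min'_mem _ hne
    set y := Finset.min' _ hne with hydef
    rw [Finset.mem_filter] at hy
    refine ⟨(x, y), ?_, rfl⟩
    rw [mem_compEdges]
    refine ⟨⟨?_, hy.2⟩, hx.2⟩
    refine hH.adj_of_consecutive hy.2 (compSet_reachable hx.2 hy.1) fun w hw hxw => ?_
    exact Finset.min'_le _ _ (Finset.mem_filter.mpr ⟨mem_compSet_of_reachable hx.2 hw, hxw⟩)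

theorem IsIndifference.sign_orderEmb (hH : H.IsIndifference) (hf : H.IsSigning f)
    (C : H.ConnectedComponent) (i : ℕ) (hi : i < (compSet C).card) :
    f ((compSet C).orderEmbOfFin rfl ⟨i, hi⟩) = (-1) ^ i * f (compMin C) := by
  induction i with
  | zero =>
    have := Finset.orderEmbOfFin_zero (s := compSet C) rfl hi
    rw [this]; simp [compMin]
  | succ i ih =>
    have hi' : i < (compSet C).card := by omega
    have hadj : H.Adj ((compSet C).orderEmbOfFin rfl ⟨i, hi'⟩)
        ((compSet C).orderEmbOfFin rfl ⟨i + 1, hi⟩) := by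
      refine hH.adj_of_consecutive ?_ (compSet_reachable (Finset.orderEmbOfFin_mem _ _ _)
        (Finset.orderEmbOfFin_mem _ _ _)) fun w hw hlt => ?_
      · simp
      · have hw' := mem_compSet_of_reachable (Finset.orderEmbOfFin_mem _ _ _) hw
        rw [← Finset.mem_coe, ← Finset.range_orderEmbOfFin (compSet C) rfl] at hw'
        obtain ⟨j, rfl⟩ := hw'
        rw [OrderEmbedding.lt_iff_lt, Fin.lt_def] at hlt
        rw [OrderEmbedding.le_iff_le, Fin.le_def]
        exact hlt
    rw [hf.adj _ _ hadj, ih hi', pow_succ]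
    ring

theorem IsIndifference.sum_compSet (hH : H.IsIndifference) (hf : H.IsSigning f)
    (C : H.ConnectedComponent) :
    ∑ v ∈ compSet C, f v = if Even (compSet C).card then 0 else f (compMin C) := by
  have h1 : ∑ v ∈ compSet C, f v = ∑ i : Fin (compSet C).card,
      f ((compSet C).orderEmbOfFin rfl i) := by
    conv_lhs => rw [← Finset.map_orderEmbOfFin_univ (compSet C) rfl]
    rw [Finset.sum_map]
    rfl
  rw [h1]
  have h2 : ∀ i : Fin (compSet C).card, f ((compSet C).orderEmbOfFin rfl i) =
      (-1) ^ (i : ℕ) * f (compMin C) := fun i => hH.sign_orderEmb hf C i i.2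
  simp_rw [h2]
  rw [← Finset.sum_mul, Fin.sum_univ_eq_sum_range fun i => (-1 : ℤ) ^ i, neg_one_geom_sum]
  split_ifs <;> simp

/-- The lower ends are all vertices but the last, so this is an alternating sum with one term fewer
and the parity cases of `sum_compSet` trade places. -/
theorem IsIndifference.sum_sign_compEdges (hH : H.IsIndifference) (hf : H.IsSigning f)
    (C : H.ConnectedComponent) :
    ∑ p ∈ compEdges C, f p.1 = if Even (compSet C).card then f (compMin C) else 0 := by
  classical
  have hpos := (compSet_nonempty C).card_pos
  rw [hH.sum_compEdges hf C f, Finset.sum_erase_eq_sub (Finset.max'_mem _ _),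
    hH.sum_compSet hf]
  have h1 := Finset.orderEmbOfFin_last (s := compSet C) rfl hpos
  have h2 := hH.sign_orderEmb hf C ((compSet C).card - 1) (by omega)
  rw [← h1, h2]
  split_ifs with h
  · rw [Odd.neg_one_pow (Nat.Even.sub_odd hpos h odd_one)]; ring
  · rw [Even.neg_one_pow (Nat.Odd.sub_odd (Nat.not_even_iff_odd.mp h) odd_one)]; ring

theorem IsIndifference.card_compEdges (hH : H.IsIndifference) (hf : H.IsSigning f)
    (C : H.ConnectedComponent) : ((compEdges C).card : ℤ) = (compSet C).card - 1 := by
  classical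
  have h := hH.sum_compEdges hf C fun _ => 1
  have hpos := (compSet_nonempty C).card_pos
  simp only [Finset.sum_const, nsmul_eq_mul, mul_one] at h
  rw [h, Finset.card_erase_of_mem (Finset.max'_mem _ _)]
  omega

theorem two_mul_card_filter_eq_one {ι : Type*} (t : Finset ι) (g : ι → ℤ)
    (hg : ∀ i, g i = 1 ∨ g i = -1) :
    2 * ((t.filter fun i => g i = 1).card : ℤ) = t.card + ∑ i ∈ t, g i := by
  rw [Finset.card_filter, Finset.card_eq_sum_ones]
  push_cast
  rw [Finset.mul_sum, ← Finset.sum_add_distrib]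
  refine Finset.sum_congr rfl fun i _ => ?_
  rcases hg i with h | h <;> simp [h]

/-- Together with `two_mul_card_ascents` this carries both the symmetry and the two-variable count:
color counts are balanced on even paths, and ascent counts do not depend on the coloring on odd
paths. -/
theorem IsIndifference.two_mul_card_pos (hH : H.IsIndifference) (hf : H.IsSigning f)
    (C : H.ConnectedComponent) :
    2 * (((compSet C).filter fun v => f v = 1).card : ℤ) =
      (compSet C).card + if Even (compSet C).card then 0 else f (compMin C) := by
  rw [two_mul_card_filter_eq_one _ _ hf.sign, hH.sum_compSet hf]

theorem IsIndifference.two_mul_card_ascents (hH : H.IsIndifference) (hf : H.IsSigning f)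
    (C : H.ConnectedComponent) :
    2 * (((compEdges C).filter fun p => f p.1 = 1).card : ℤ) =
      (compSet C).card - 1 + if Even (compSet C).card then f (compMin C) else 0 := by
  have h := two_mul_card_filter_eq_one (compEdges C) (fun p => f p.1) fun p => hf.sign p.1
  rwa [hH.sum_sign_compEdges hf, hH.card_compEdges hf] at h

end SimpleGraph

end Paths

/-! ### Symmetry of the chromatic quasisymmetric function -/

section Symmetry

open SimpleGraph

theorem NaturalUnitIntervalOrder.inc_adj_of_lt {n : ℕ} (P : NaturalUnitIntervalOrder n)
    {i j : Fin n} (hij : i < j) : P.inc.Adj i j ↔ j ≤ P.m i := by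
  change (¬ (i = j ∨ P.m i < j) ∧ ¬ (j = i ∨ P.m j < i)) ↔ _
  have := P.le_m j
  have h3 : ¬ P.m j < i := not_lt.mpr (hij.le.trans this)
  simp [hij.ne, hij.ne', h3]

/-- The interval spanned by an edge is a clique; later arguments use no other property of `inc(P)`.
-/
theorem NaturalUnitIntervalOrder.inc_adj_of_between {n : ℕ} (P : NaturalUnitIntervalOrder n)
    (x u v y : Fin n) (h1 : x ≤ u) (h2 : u < v) (h3 : v ≤ y) (h : P.inc.Adj x y) :
    P.inc.Adj u v := by
  rw [P.inc_adj_of_lt (h1.trans_lt (h2.trans_le h3))] at h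
  rw [P.inc_adj_of_lt h2]
  exact (h3.trans h).trans (P.monotone_m h1)

/-! ### The involution exchanging two colors on odd components -/

section Flip

variable {n : ℕ} {G : SimpleGraph (Fin n)}

/-- The edges of `G` whose ends are colored with `a` or `b`. -/
def twoColored (G : SimpleGraph (Fin n)) (κ : Fin n → ℕ+) (a b : ℕ+) : SimpleGraph (Fin n) where
  Adj u v := G.Adj u v ∧ (κ u = a ∨ κ u = b) ∧ (κ v = a ∨ κ v = b)
  symm := ⟨fun _ _ h => ⟨h.1.symm, h.2.2, h.2.1⟩⟩
  loopless := ⟨fun _ h => G.irrefl h.1⟩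

theorem twoColored_of_reachable {κ : Fin n → ℕ+} {a b : ℕ+} {u v : Fin n}
    (h : (twoColored G κ a b).Reachable u v) (hu : κ u = a ∨ κ u = b) : κ v = a ∨ κ v = b := by
  obtain ⟨p⟩ := h
  induction p with
  | nil => exact hu
  | cons h _ ih => exact ih h.2.2

/-- A vertex of a third color may lie between the ends of an edge, but it is isolated in the
subgraph; the reachability hypotheses exclude it. -/
theorem isIndifference_twoColored
    (hG : ∀ x u v y, x ≤ u → u < v → v ≤ y → G.Adj x y → G.Adj u v) (κ : Fin n → ℕ+) (a b : ℕ+) :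
    (twoColored G κ a b).IsIndifference := fun x u v y h1 h2 h3 h hu hv =>
  ⟨hG x u v y h1 h2 h3 h.1, twoColored_of_reachable hu h.2.1, twoColored_of_reachable hv h.2.1⟩

theorem isSigning_twoColored (κ : G.Coloring ℕ+) (a b c : ℕ+) (hc : c = a ∨ c = b) :
    (twoColored G κ a b).IsSigning fun v => if κ v = c then 1 else -1 where
  sign v := by split_ifs <;> simp
  adj u v h := by
    have := κ.valid h.1
    obtain ⟨_, hu, hv⟩ := h
    rcases hu with hu | hu <;> rcases hv with hv | hv <;> rcases hc with rfl | rfl <;>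
      simp_all [eq_comm]

/-- The component of `v` has odd size. -/
def OddAt (H : SimpleGraph (Fin n)) (v : Fin n) : Prop :=
  Odd (compSet (H.connectedComponentMk v)).card

open Classical in
/-- Exchange the colors `a` and `b` on the odd components of the subgraph that they span. -/
noncomputable def flipFun (G : SimpleGraph (Fin n)) (κ : Fin n → ℕ+) (a b : ℕ+) : Fin n → ℕ+ :=
  fun v => if OddAt (twoColored G κ a b) v then Equiv.swap a b (κ v) else κ v

theorem swap_eq_or_iff (a b c : ℕ+) :
    (Equiv.swap a b c = a ∨ Equiv.swap a b c = b) ↔ (c = a ∨ c = b) := by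
  rw [Equiv.swap_apply_eq_iff, Equiv.swap_apply_eq_iff, Equiv.swap_apply_left,
    Equiv.swap_apply_right, or_comm]

theorem flipFun_eq_or_iff (κ : Fin n → ℕ+) (a b : ℕ+) (v : Fin n) :
    (flipFun G κ a b v = a ∨ flipFun G κ a b v = b) ↔ (κ v = a ∨ κ v = b) := by
  unfold flipFun
  split_ifs
  · exact swap_eq_or_iff a b (κ v)
  · rfl

theorem flipFun_of_not {κ : Fin n → ℕ+} {a b : ℕ+} {v : Fin n} (h : ¬ (κ v = a ∨ κ v = b)) :
    flipFun G κ a b v = κ v := by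
  unfold flipFun
  push Not at h
  rw [Equiv.swap_apply_of_ne_of_ne h.1 h.2, ite_self]

/-- The flip preserves the set of vertices colored `a` or `b`, so the components to be flipped stay
the same and the flip is an involution. -/
theorem twoColored_flipFun (κ : Fin n → ℕ+) (a b : ℕ+) :
    twoColored G (flipFun G κ a b) a b = twoColored G κ a b := by
  ext u v
  simp only [twoColored, flipFun_eq_or_iff]

theorem flipFun_flipFun (κ : Fin n → ℕ+) (a b : ℕ+) :
    flipFun G (flipFun G κ a b) a b = κ := by
  funext v
  rw [flipFun, twoColored_flipFun]
  unfold flipFun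
  split_ifs
  · exact Equiv.swap_apply_self a b _
  · rfl

/-- Adjacent vertices colored from `{a, b}` lie in one component and are flipped together or not at
all; third colors do not change. -/
theorem flipFun_proper (κ : G.Coloring ℕ+) (a b : ℕ+) {u v : Fin n} (h : G.Adj u v) :
    flipFun G κ a b u ≠ flipFun G κ a b v := by
  by_cases hu : κ u = a ∨ κ u = b
  · by_cases hv : κ v = a ∨ κ v = b
    · have hadj : (twoColored G κ a b).Adj u v := ⟨h, hu, hv⟩
      have hmk : OddAt (twoColored G κ a b) u ↔ OddAt (twoColored G κ a b) v := by
        rw [OddAt, OddAt, ConnectedComponent.connectedComponentMk_eq_of_adj hadj]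
      by_cases hO : OddAt (twoColored G κ a b) u
      · rw [flipFun, flipFun, if_pos hO, if_pos (hmk.mp hO)]
        exact fun he => κ.valid h ((Equiv.swap a b).injective he)
      · rw [flipFun, flipFun, if_neg hO, if_neg (hmk.not.mp hO)]
        exact κ.valid h
    · intro he
      have := (flipFun_eq_or_iff (G := G) κ a b u).mpr hu
      rw [he, flipFun_of_not hv] at this
      exact hv this
  · by_cases hv : κ v = a ∨ κ v = b
    · intro he
      have := (flipFun_eq_or_iff (G := G) κ a b v).mpr hv
      rw [← he, flipFun_of_not hu] at this
      exact hu this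
    · rw [flipFun_of_not hu, flipFun_of_not hv]
      exact κ.valid h

/-- `flipFun` as an operation on proper colorings. -/
noncomputable def flipColoring (a b : ℕ+) (κ : G.Coloring ℕ+) : G.Coloring ℕ+ :=
  Coloring.mk (flipFun G κ a b) fun h => flipFun_proper κ a b h

theorem flipColoring_apply (a b : ℕ+) (κ : G.Coloring ℕ+) (v : Fin n) :
    flipColoring a b κ v = flipFun G κ a b v := rfl

theorem flipColoring_flipColoring (a b : ℕ+) (κ : G.Coloring ℕ+) :
    flipColoring a b (flipColoring a b κ) = κ := by
  apply DFunLike.coe_injective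
  exact flipFun_flipFun κ a b

theorem colorWeight_apply (κ : G.Coloring ℕ+) (c : ℕ+) :
    colorWeight G κ c = (Finset.univ.filter fun v => κ v = c).card := by
  rw [colorWeight, Finsupp.finsetSum_apply, Finset.card_filter]
  simp [Finsupp.single_apply]

theorem card_filter_eq_sum_compSet (H : SimpleGraph (Fin n)) [Fintype H.ConnectedComponent]
    (p : Fin n → Prop) [DecidablePred p] : (Finset.univ.filter p).card =
      ∑ C : H.ConnectedComponent, ((compSet C).filter p).card := by
  classical
  rw [Finset.card_eq_sum_card_fiberwise (f := H.connectedComponentMk) (t := Finset.univ)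
    (by intro x _; simp)]
  refine Finset.sum_congr rfl fun C _ => ?_
  congr 1
  ext v
  simp [mem_compSet, and_comm]

theorem card_filter_eq_sum_compEdges (H : SimpleGraph (Fin n)) [Fintype H.ConnectedComponent]
    [DecidableRel H.Adj] (p : Fin n × Fin n → Prop) [DecidablePred p] :
    (Finset.univ.filter fun e : Fin n × Fin n => (H.Adj e.1 e.2 ∧ e.1 < e.2) ∧ p e).card =
      ∑ C : H.ConnectedComponent, ((compEdges C).filter p).card := by
  classical
  rw [Finset.card_eq_sum_card_fiberwise (f := fun e => H.connectedComponentMk e.1)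
    (t := Finset.univ) (by intro x _; simp)]
  refine Finset.sum_congr rfl fun C _ => ?_
  congr 1
  ext e
  simp [mem_compSet, mem_compEdges]
  tauto

theorem flipFun_of_mem_odd {κ : Fin n → ℕ+} {a b : ℕ+}
    {C : (twoColored G κ a b).ConnectedComponent} (hC : Odd (compSet C).card) {v : Fin n}
    (hv : v ∈ compSet C) : flipFun G κ a b v = Equiv.swap a b (κ v) := by
  rw [mem_compSet] at hv
  rw [flipFun, if_pos]
  rwa [OddAt, hv]

theorem flipFun_of_mem_even {κ : Fin n → ℕ+} {a b : ℕ+}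
    {C : (twoColored G κ a b).ConnectedComponent} (hC : Even (compSet C).card) {v : Fin n}
    (hv : v ∈ compSet C) : flipFun G κ a b v = κ v := by
  rw [mem_compSet] at hv
  rw [flipFun, if_neg]
  rwa [OddAt, hv, Nat.not_odd_iff_even]

/-- Flipping an odd path exchanges its two color counts, and on an even path they are already equal.
-/
theorem colorWeight_flipColoring
    (hG : ∀ x u v y, x ≤ u → u < v → v ≤ y → G.Adj x y → G.Adj u v) (κ : G.Coloring ℕ+)
    (a b : ℕ+) : colorWeight G (flipColoring a b κ) =
      Finsupp.embDomain (Equiv.swap a b).toEmbedding (colorWeight G κ) := by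
  classical
  ext c
  have hc : c = (Equiv.swap a b).toEmbedding (Equiv.swap a b c) := by simp
  conv_rhs => rw [hc]
  rw [Finsupp.embDomain_apply_self, colorWeight_apply, colorWeight_apply,
    card_filter_eq_sum_compSet (twoColored G κ a b),
    card_filter_eq_sum_compSet (twoColored G κ a b)]
  refine Finset.sum_congr rfl fun C _ => ?_
  rcases Nat.even_or_odd (compSet C).card with hC | hC
  · have h1 : ((compSet C).filter fun v => flipColoring a b κ v = c) =
        (compSet C).filter fun v => κ v = c :=
      Finset.filter_congr fun v hv => by rw [flipColoring_apply, flipFun_of_mem_even hC hv]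
    rw [h1]
    have key : ∀ c', c' = a ∨ c' = b →
        2 * (((compSet C).filter fun v => κ v = c').card : ℤ) = (compSet C).card := by
      intro c' hc'
      have := (isIndifference_twoColored hG κ a b).two_mul_card_pos
        (isSigning_twoColored κ a b c' hc') C
      rw [if_pos hC, add_zero] at this
      rw [← this]
      congr 3
      ext v
      by_cases h : κ v = c' <;> simp [h]
    by_cases hab : c = a ∨ c = b
    · have h2 := key c hab
      have h3 := key (Equiv.swap a b c) ((swap_eq_or_iff a b c).mpr hab)
      omega
    · push Not at hab
      rw [Equiv.swap_apply_of_ne_of_ne hab.1 hab.2]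
  · congr 1
    refine Finset.filter_congr fun v hv => ?_
    rw [flipColoring_apply, flipFun_of_mem_odd hC hv, Equiv.swap_apply_eq_iff]

theorem lt_iff_eq_left {α : Type*} [LinearOrder α] {a b x y : α} (hab : a < b)
    (hx : x = a ∨ x = b) (hy : y = a ∨ y = b) (hxy : x ≠ y) : x < y ↔ x = a := by
  rcases hx with rfl | rfl <;> rcases hy with rfl | rfl
  · exact absurd rfl hxy
  · simp [hab]
  · simp [hab.le, hab.ne']
  · exact absurd rfl hxy

/-- No color lies strictly between `a` and `b`, so comparisons with a third color are unaffected.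
Within the two colors, even paths are untouched and odd paths have equally many ascents before and
after. -/
theorem ascents_flipColoring
    (hG : ∀ x u v y, x ≤ u → u < v → v ≤ y → G.Adj x y → G.Adj u v) (κ : G.Coloring ℕ+)
    {a b : ℕ+} (hab : a < b) (hb : ∀ c, c ≠ a → c ≠ b → (c < a ↔ c < b)) :
    ascents G (flipColoring a b κ) = ascents G κ := by
  classical
  set H := twoColored G κ a b with hH
  -- On an edge of `H` an ascent means that the lower end has the smaller color `a`, which makes
  -- ascents countable path by path.
  have split : ∀ κ' : Fin n → ℕ+, (∀ u v, H.Adj u v → (κ' u < κ' v ↔ κ' u = a)) →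
      Set.ncard {p : Fin n × Fin n | G.Adj p.1 p.2 ∧ p.1 < p.2 ∧ κ' p.1 < κ' p.2} =
      (Finset.univ.filter fun p : Fin n × Fin n =>
        (G.Adj p.1 p.2 ∧ ¬ H.Adj p.1 p.2) ∧ p.1 < p.2 ∧ κ' p.1 < κ' p.2).card +
      ∑ C : H.ConnectedComponent, ((compEdges C).filter fun p => κ' p.1 = a).card := by
    intro κ' hκ'
    rw [← card_filter_eq_sum_compEdges H fun p => κ' p.1 = a, ← Finset.card_union_of_disjoint,
      ← Set.ncard_coe_finset]
    · congr 1
      ext p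
      have hHG : H.Adj p.1 p.2 → G.Adj p.1 p.2 := fun h => h.1
      have := hκ' p.1 p.2
      simp
      tauto
    · rw [Finset.disjoint_filter]
      tauto
  have h1 : ∀ u v, H.Adj u v → (κ u < κ v ↔ κ u = a) := by
    rintro u v ⟨h, hu, hv⟩
    exact lt_iff_eq_left hab hu hv (κ.valid h)
  have h2 : ∀ u v, H.Adj u v → (flipFun G κ a b u < flipFun G κ a b v ↔
      flipFun G κ a b u = a) := by
    rintro u v ⟨h, hu, hv⟩
    rw [← flipFun_eq_or_iff (G := G)] at hu hv
    exact lt_iff_eq_left hab hu hv (flipFun_proper κ a b h)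
  unfold ascents
  simp_rw [flipColoring_apply]
  rw [split _ h1, split _ h2]
  congr 1
  · congr 1
    refine Finset.filter_congr fun p _ => and_congr_right fun hp => and_congr_right fun _ => ?_
    have hb' : ∀ c, c ≠ a → c ≠ b → (a < c ↔ b < c) := by
      intro c hca hcb
      rw [← not_le, ← not_le, hca.le_iff_lt, hcb.le_iff_lt, hb c hca hcb]
    by_cases hu : κ p.1 = a ∨ κ p.1 = b
    · have hv : ¬ (κ p.2 = a ∨ κ p.2 = b) := fun hv => hp.2 ⟨hp.1, hu, hv⟩
      rw [flipFun_of_not hv]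
      have hu' := (flipFun_eq_or_iff (G := G) κ a b p.1).mpr hu
      push Not at hv
      have := hb' _ hv.1 hv.2
      rcases hu with hu | hu <;> rcases hu' with hu' | hu' <;> rw [hu, hu'] <;> tauto
    · rw [flipFun_of_not hu]
      by_cases hv : κ p.2 = a ∨ κ p.2 = b
      · have hv' := (flipFun_eq_or_iff (G := G) κ a b p.2).mpr hv
        push Not at hu
        have := hb _ hu.1 hu.2
        rcases hv with hv | hv <;> rcases hv' with hv' | hv' <;> rw [hv, hv'] <;> tauto
      · rw [flipFun_of_not hv]
  · refine Finset.sum_congr rfl fun C _ => ?_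
    rcases Nat.even_or_odd (compSet C).card with hC | hC
    · congr 1
      refine Finset.filter_congr fun p hp => ?_
      rw [flipFun_of_mem_even hC (mem_compEdges.mp hp).2]
    · have h3 : ((compEdges C).filter fun p => flipFun G κ a b p.1 = a) =
          (compEdges C).filter fun p => κ p.1 = b :=
        Finset.filter_congr fun p hp => by
          rw [flipFun_of_mem_odd hC (mem_compEdges.mp hp).2, Equiv.swap_apply_eq_iff,
            Equiv.swap_apply_left]
      rw [h3]
      -- An odd path has an even number of edges, and exactly half of their lower ends have each
      -- color.
      have key : ∀ c', c' = a ∨ c' = b →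
          2 * (((compEdges C).filter fun p => κ p.1 = c').card : ℤ) = (compSet C).card - 1 := by
        intro c' hc'
        have := (isIndifference_twoColored hG κ a b).two_mul_card_ascents
          (isSigning_twoColored κ a b c' hc') C
        rw [if_neg (Nat.not_even_iff_odd.mpr hC), add_zero] at this
        rw [← this]
        congr 3
        ext p
        by_cases h : κ p.1 = c' <;> simp [h]
      have h4 := key a (Or.inl rfl)
      have h5 := key b (Or.inr rfl)
      omega

theorem coeff_chromaticQuasisymmetric_swap
    (hG : ∀ x u v y, x ≤ u → u < v → v ≤ y → G.Adj x y → G.Adj u v)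
    {a b : ℕ+} (hab : a < b) (hb : ∀ c, c ≠ a → c ≠ b → (c < a ↔ c < b)) (d : ℕ+ →₀ ℕ) :
    MvPowerSeries.coeff (Finsupp.embDomain (Equiv.swap a b).toEmbedding d)
      (chromaticQuasisymmetric G) = MvPowerSeries.coeff d (chromaticQuasisymmetric G) := by
  have hinv : ∀ d : ℕ+ →₀ ℕ, Finsupp.embDomain (Equiv.swap a b).toEmbedding
      (Finsupp.embDomain (Equiv.swap a b).toEmbedding d) = d := by
    intro d
    rw [Finsupp.embDomain_eq_mapDomain, Finsupp.embDomain_eq_mapDomain, ← Finsupp.mapDomain_comp]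
    conv_rhs => rw [← Finsupp.mapDomain_id (v := d)]
    congr 1
    ext z
    simp
  symm
  refine Finset.sum_bij' (fun κ _ => flipColoring a b κ) (fun κ _ => flipColoring a b κ) ?_ ?_
    (fun κ _ => flipColoring_flipColoring a b κ) (fun κ _ => flipColoring_flipColoring a b κ) ?_
  · intro κ hκ
    rw [Set.Finite.mem_toFinset] at hκ ⊢
    change colorWeight G κ = d at hκ
    change colorWeight G _ = _
    rw [colorWeight_flipColoring hG, hκ]
  · intro κ hκ
    rw [Set.Finite.mem_toFinset] at hκ ⊢
    change colorWeight G κ = _ at hκ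
    change colorWeight G _ = _
    rw [colorWeight_flipColoring hG, hκ, hinv]
  · intro κ _
    rw [ascents_flipColoring hG κ hab hb]

end Flip

/-- Adjacent transpositions generate the others, by conjugating `(a b)` with `(b b+1)`. -/
theorem isSymmetricSeries_of_adjacent {F : MvPowerSeries ℕ+ ℚ[X]}
    (h : ∀ (a : ℕ+) (d : ℕ+ →₀ ℕ),
      MvPowerSeries.coeff (Finsupp.embDomain (Equiv.swap a (a + 1)).toEmbedding d) F =
        MvPowerSeries.coeff d F) : IsSymmetricSeries F := by
  have key : ∀ (a b : ℕ+) (d : ℕ+ →₀ ℕ), a < b →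
      MvPowerSeries.coeff (d.mapDomain (Equiv.swap a b)) F = MvPowerSeries.coeff d F := by
    have hadj : ∀ (a : ℕ+) (d : ℕ+ →₀ ℕ),
        MvPowerSeries.coeff (d.mapDomain (Equiv.swap a (a + 1))) F =
          MvPowerSeries.coeff d F := by
      intro a d
      rw [← h a d, Finsupp.embDomain_eq_mapDomain]
      rfl
    intro a b
    induction b using PNat.recOn with
    | one => intro d hab; exact absurd hab (not_lt.mpr one_le)
    | succ b ih =>
      intro d hab
      rcases (PNat.lt_add_one_iff.mp hab).eq_or_lt with rfl | hlt
      · exact hadj a d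
      · have hconj : Equiv.swap a (b + 1) =
            Equiv.swap b (b + 1) * Equiv.swap a b * Equiv.swap b (b + 1) := by
          rw [Equiv.swap_mul_swap_mul_swap hlt.ne hab.ne, Equiv.swap_comm]
        have hfun : (⇑(Equiv.swap a (b + 1)) : ℕ+ → ℕ+) =
            Equiv.swap b (b + 1) ∘ (Equiv.swap a b ∘ Equiv.swap b (b + 1)) := by
          rw [hconj]; rfl
        rw [hfun, Finsupp.mapDomain_comp, Finsupp.mapDomain_comp, hadj, ih _ hlt, hadj]
  intro a b
  ext1 d
  rw [MvPowerSeries.coeff_killCompl, Finsupp.embDomain_eq_mapDomain]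
  change MvPowerSeries.coeff (d.mapDomain (Equiv.swap a b)) F = _
  rcases lt_trichotomy a b with hab | rfl | hab
  · exact key a b d hab
  · rw [Equiv.swap_self]
    congr 1
    exact congrArg (fun e => MvPowerSeries.coeff e) Finsupp.mapDomain_id
  · rw [Equiv.swap_comm]
    exact key b a d hab

theorem NaturalUnitIntervalOrder.isSymmetricSeries_chromaticQuasisymmetric {n : ℕ}
    (P : NaturalUnitIntervalOrder n) : IsSymmetricSeries (chromaticQuasisymmetric P.inc) := by
  refine isSymmetricSeries_of_adjacent fun a d => ?_
  refine coeff_chromaticQuasisymmetric_swap P.inc_adj_of_between (PNat.lt_add_right a 1) ?_ d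
  intro c hca hcb
  rw [PNat.lt_add_one_iff]
  exact hca.le_iff_lt.symm

theorem degree_colorWeight {n : ℕ} {G : SimpleGraph (Fin n)} (κ : G.Coloring ℕ+) :
    (colorWeight G κ).degree = n := by
  rw [colorWeight, map_sum]
  simp

theorem NaturalUnitIntervalOrder.existsUnique_expansion {n : ℕ} (P : NaturalUnitIntervalOrder n) :
    ∃! c : n.Partition → ℚ[X], IsElementaryExpansion P c := by
  obtain ⟨c, hc⟩ := P.isSymmetricSeries_chromaticQuasisymmetric.exists_expansion n (by
    intro d hd
    refine Finset.sum_eq_zero fun κ hκ => ?_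
    rw [Set.Finite.mem_toFinset] at hκ
    exact absurd (hκ ▸ degree_colorWeight κ) hd)
  exact ⟨c, hc, fun c' hc' => expansion_unique (hc'.symm.trans hc)⟩

end Symmetry

/-! ### Colorings with two colors -/

section TwoVariables

open SimpleGraph MvPolynomial

theorem SimpleGraph.IsSigning.mul_eq_of_reachable {V : Type*} {H : SimpleGraph V} {f h : V → ℤ}
    (hf : H.IsSigning f) (hh : H.IsSigning h) {u v : V} (huv : H.Reachable u v) :
    f u * h u = f v * h v := by
  obtain ⟨p⟩ := huv
  induction p with
  | nil => rfl
  | cons hadj _ ih => rw [← ih, hf.adj _ _ hadj, hh.adj _ _ hadj]; ring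

theorem SimpleGraph.IsSigning.mul_self {V : Type*} {H : SimpleGraph V} {f : V → ℤ}
    (hf : H.IsSigning f) (v : V) : f v * f v = 1 := by
  rcases hf.sign v with h | h <;> simp [h]

variable {n : ℕ} {G : SimpleGraph (Fin n)}

/-- An edge from `u` to some `v > u + 1` would form a triangle with `u + 1`, so edges join
consecutive integers. -/
theorem isSigning_parity (hG : ∀ x u v y, x ≤ u → u < v → v ≤ y → G.Adj x y → G.Adj u v)
    (hcf : G.CliqueFree 3) : G.IsSigning fun v => (-1) ^ (v : ℕ) where
  sign v := neg_one_pow_eq_or ℤ v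
  adj := by
    have key : ∀ u v : Fin n, G.Adj u v → u < v → (v : ℕ) = u + 1 := by
      intro u v h huv
      by_contra hne
      have hlt : (u : ℕ) + 1 < v := by
        rw [Fin.lt_def] at huv; omega
      set w : Fin n := ⟨u + 1, hlt.trans v.2⟩ with hw
      have h1 : u < w := by rw [Fin.lt_def]; simp [hw]
      have h2 : w < v := hlt
      refine hcf {u, w, v} (is3Clique_triple_iff.mpr ⟨?_, h, ?_⟩)
      · exact hG u u w v le_rfl h1 h2.le h
      · exact hG u w v v h1.le h2 le_rfl h
    intro u v h
    rcases lt_trichotomy u v with huv | rfl | huv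
    · rw [key u v h huv, pow_succ]; ring
    · exact absurd h (G.irrefl)
    · rw [key v u h.symm huv, pow_succ]; ring

theorem isIndifference_of_between
    (hG : ∀ x u v y, x ≤ u → u < v → v ≤ y → G.Adj x y → G.Adj u v) : G.IsIndifference :=
  fun x u v y h1 h2 h3 h _ _ => hG x u v y h1 h2 h3 h

/-- The signing obtained from the signing `f` by prescribing the sign of the least vertex of each
component. -/
noncomputable def resign (f : Fin n → ℤ) (g : G.ConnectedComponent → Bool) (v : Fin n) : ℤ :=
  f v * f (compMin (G.connectedComponentMk v)) *
    if g (G.connectedComponentMk v) then 1 else -1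

theorem isSigning_resign {f : Fin n → ℤ} (hf : G.IsSigning f)
    (g : G.ConnectedComponent → Bool) : G.IsSigning (resign f g) where
  sign v := by
    unfold resign
    rcases hf.sign v with h | h <;>
      rcases hf.sign (compMin (G.connectedComponentMk v)) with h' | h' <;>
      split_ifs <;> simp [h, h']
  adj u v h := by
    unfold resign
    rw [ConnectedComponent.connectedComponentMk_eq_of_adj h, hf.adj u v h]
    ring

theorem resign_compMin {f : Fin n → ℤ} (hf : G.IsSigning f) (g : G.ConnectedComponent → Bool)
    (C : G.ConnectedComponent) : resign f g (compMin C) = if g C then 1 else -1 := by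
  have h : G.connectedComponentMk (compMin C) = C := mem_compSet.mp (compMin_mem C)
  rw [resign, h, hf.mul_self, one_mul]

/-- The product of two signings is constant on components, so a signing is determined by its values
at the least vertices. -/
theorem eq_resign {f h : Fin n → ℤ} (hf : G.IsSigning f) (hh : G.IsSigning h)
    (v : Fin n) : h v = resign f (fun C : G.ConnectedComponent => decide (h (compMin C) = 1)) v := by
  set m := compMin (G.connectedComponentMk v) with hm
  have hmem := mem_compSet.mp (compMin_mem (G.connectedComponentMk v))
  have h1 : h m * f m = h v * f v :=
    hh.mul_eq_of_reachable hf (ConnectedComponent.exact hmem)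
  have h2 : (if h m = 1 then (1 : ℤ) else -1) = h m := by
    rcases hh.sign m with h' | h' <;> simp [h']
  have h3 := hf.mul_self v
  simp only [resign, decide_eq_true_eq, ← hm, h2]
  calc h v = h v * f v * f v := by rw [mul_assoc, h3, mul_one]
    _ = _ := by rw [← h1]; ring

/-- The coloring by `1` and `2` associated with a signing. -/
noncomputable def signColoring {f : Fin n → ℤ} (hf : G.IsSigning f) : G.Coloring ℕ+ :=
  Coloring.mk (fun v => if f v = 1 then 1 else 2) fun {u v} h => by
    rw [hf.adj u v h]
    rcases hf.sign u with h' | h' <;> simp [h']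

theorem signColoring_apply {f : Fin n → ℤ} (hf : G.IsSigning f) (v : Fin n) :
    signColoring hf v = if f v = 1 then 1 else 2 := rfl

theorem signColoring_eq_one {f : Fin n → ℤ} (hf : G.IsSigning f) (v : Fin n) :
    signColoring hf v = 1 ↔ f v = 1 := by
  rw [signColoring_apply]
  split_ifs with h <;> simp [h]

theorem signColoring_eq_or {f : Fin n → ℤ} (hf : G.IsSigning f) (v : Fin n) :
    signColoring hf v = 1 ∨ signColoring hf v = 2 := by
  rw [signColoring_apply]
  split_ifs <;> simp

theorem isSigning_of_coloring (κ : G.Coloring ℕ+) (hκ : ∀ v, κ v = 1 ∨ κ v = 2) :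
    G.IsSigning fun v => if κ v = 1 then 1 else -1 where
  sign v := by split_ifs <;> simp
  adj u v h := by
    have := κ.valid h
    rcases hκ u with hu | hu <;> rcases hκ v with hv | hv <;> simp_all

theorem signColoring_isSigning_of_coloring (κ : G.Coloring ℕ+) (hκ : ∀ v, κ v = 1 ∨ κ v = 2) :
    signColoring (isSigning_of_coloring κ hκ) = κ := by
  apply DFunLike.coe_injective
  funext v
  rw [signColoring_apply]
  rcases hκ v with h | h <;> simp [h]

theorem coloring_eq_or_of_colorWeight (κ : G.Coloring ℕ+) (d : Fin 2 →₀ ℕ)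
    (h : colorWeight G κ = Finsupp.embDomain (finPNat 2) d) (v : Fin n) :
    κ v = 1 ∨ κ v = 2 := by
  have h1 : colorWeight G κ (κ v) ≠ 0 := by
    rw [colorWeight_apply, Finset.card_ne_zero]
    exact ⟨v, by simp⟩
  rw [h] at h1
  have h2 : κ v ∈ Set.range (finPNat 2) := by
    by_contra hne
    exact h1 (Finsupp.embDomain_of_notMem_range _ _ _ hne)
  rw [finPNat_range] at h2
  have h3 : (κ v : ℕ) ≤ 2 := h2
  have h4 := (κ v).pos
  rcases (show (κ v : ℕ) = 1 ∨ (κ v : ℕ) = 2 by omega) with h5 | h5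
  · exact Or.inl (PNat.eq h5)
  · exact Or.inr (PNat.eq h5)

theorem killCompl_chromaticQuasisymmetric_eq_zero (hcf : ¬ G.CliqueFree 3) :
    MvPowerSeries.killCompl (finPNat 2) (chromaticQuasisymmetric G) = 0 := by
  ext1 d
  rw [MvPowerSeries.coeff_killCompl]
  refine Finset.sum_eq_zero fun κ hκ => ?_
  rw [Set.Finite.mem_toFinset] at hκ
  exfalso
  apply hcf
  intro s hs
  obtain ⟨u, v, w, huv, huw, hvw, _⟩ := is3Clique_iff.mp hs
  have h1 := κ.valid huv
  have h2 := κ.valid huw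
  have h3 := κ.valid hvw
  rcases coloring_eq_or_of_colorWeight κ d hκ u with hu | hu <;>
  rcases coloring_eq_or_of_colorWeight κ d hκ v with hv | hv <;>
  rcases coloring_eq_or_of_colorWeight κ d hκ w with hw | hw <;>
  simp_all

/-- The contribution of a component to the exponent vector of the coloring associated with a
signing. -/
noncomputable def compWeight (f : Fin n → ℤ) (C : G.ConnectedComponent) : Fin 2 →₀ ℕ :=
  Finsupp.single 0 ((compSet C).filter fun v => f v = 1).card +
    Finsupp.single 1 ((compSet C).filter fun v => ¬ f v = 1).card

theorem colorWeight_signColoring [Fintype G.ConnectedComponent] {f : Fin n → ℤ}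
    (hf : G.IsSigning f) : colorWeight G (signColoring hf) =
      Finsupp.embDomain (finPNat 2) (∑ C : G.ConnectedComponent, compWeight f C) := by
  have h1 : finPNat 2 0 = 1 := rfl
  have h2 : finPNat 2 1 = 2 := rfl
  ext c
  by_cases hc : c ∈ Set.range (finPNat 2)
  · obtain ⟨i, rfl⟩ := hc
    rw [Finsupp.embDomain_apply_self, colorWeight_apply, card_filter_eq_sum_compSet G,
      Finsupp.finsetSum_apply]
    refine Finset.sum_congr rfl fun C _ => ?_
    fin_cases i
    · simp [compWeight, h1, signColoring_eq_one]
    · have h3 : ∀ v, signColoring hf v = 2 ↔ ¬ f v = 1 := by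
        intro v
        rw [signColoring_apply]
        split_ifs with h <;> simp [h]
      simp [compWeight, h2, h3]
  · rw [Finsupp.embDomain_of_notMem_range _ _ _ hc, colorWeight_apply, Finset.card_eq_zero,
      Finset.filter_eq_empty_iff]
    rintro v _ rfl
    apply hc
    rcases signColoring_eq_or hf v with h | h
    · exact ⟨0, by rw [h, h1]⟩
    · exact ⟨1, by rw [h, h2]⟩

theorem ascents_signColoring [Fintype G.ConnectedComponent] {f : Fin n → ℤ}
    (hf : G.IsSigning f) : ascents G (signColoring hf) =
      ∑ C : G.ConnectedComponent, ((compEdges C).filter fun p => f p.1 = 1).card := by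
  classical
  rw [← card_filter_eq_sum_compEdges G, ascents, ← Set.ncard_coe_finset]
  congr 1
  ext p
  simp only [Set.mem_ofPred_eq, Finset.coe_filter, Finset.mem_univ, true_and, and_assoc]
  refine and_congr_right fun h => and_congr_right fun _ => ?_
  rw [lt_iff_eq_left (by decide : (1 : ℕ+) < 2) (signColoring_eq_or hf _)
    (signColoring_eq_or hf _) ((signColoring hf).valid h), signColoring_eq_one]

/-- The contribution of a component to the generating function of colorings by `1` and `2`. -/
noncomputable def compPoly (C : G.ConnectedComponent) : MvPolynomial (Fin 2) ℚ[X] :=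
  MvPolynomial.C (Polynomial.X ^ (((compSet C).card - 1) / 2) *
      if Even (compSet C).card then 1 + Polynomial.X else 1) *
    ((X 0 * X 1) ^ ((compSet C).card / 2) * if Even (compSet C).card then 1 else X 0 + X 1)

theorem monomial_single_add_single (i j : ℕ) (r : ℚ[X]) :
    monomial (Finsupp.single (0 : Fin 2) i + Finsupp.single 1 j) r =
      MvPolynomial.C r * (X 0 ^ i * X 1 ^ j) := by
  rw [X_pow_eq_monomial, X_pow_eq_monomial, monomial_mul, C_mul_monomial, one_mul, mul_one]

/-- The two signings of a path on `2m` vertices have equal weights and `m` or `m - 1` ascents; those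
of a path on `2m+1` vertices have `m` ascents each and mirrored weights. -/
theorem sum_monomial_compWeight
    (hG : ∀ x u v y, x ≤ u → u < v → v ≤ y → G.Adj x y → G.Adj u v) (C : G.ConnectedComponent)
    (f : Bool → Fin n → ℤ) (hf : ∀ s, G.IsSigning (f s))
    (hs : ∀ s, f s (compMin C) = if s then 1 else -1) :
    ∑ s : Bool, monomial (compWeight (f s) C)
      (Polynomial.X ^ ((compEdges C).filter fun p => f s p.1 = 1).card : ℚ[X]) = compPoly C := by
  have hpos := (compSet_nonempty C).card_pos
  have hb := fun s => (isIndifference_of_between hG).two_mul_card_pos (hf s) C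
  have ha := fun s => (isIndifference_of_between hG).two_mul_card_ascents (hf s) C
  have hn := fun s => Finset.card_filter_add_card_filter_not (s := compSet C) fun v => f s v = 1
  simp only [hs] at ha hb
  simp only [compWeight, monomial_single_add_single, Fintype.sum_bool, compPoly]
  have ht := And.intro (ha true) (And.intro (hb true) (hn true))
  have hf := And.intro (ha false) (And.intro (hb false) (hn false))
  generalize ((compEdges C).filter fun p => f true p.1 = 1).card = a1 at *
  generalize ((compEdges C).filter fun p => f false p.1 = 1).card = a2 at *
  generalize ((compSet C).filter fun p => f true p = 1).card = b1 at *
  generalize ((compSet C).filter fun p => f false p = 1).card = b2 at *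
  generalize ((compSet C).filter fun p => ¬ f true p = 1).card = c1 at *
  generalize ((compSet C).filter fun p => ¬ f false p = 1).card = c2 at *
  generalize (compSet C).card = k at *
  rcases Nat.even_or_odd k with hk | hk
  · simp only [if_pos hk] at ht hf ⊢
    obtain ⟨m, rfl⟩ := hk
    simp only [if_true, Bool.false_eq_true, if_false] at ht hf
    -- Components are nonempty, so the truncated subtraction in the exponent of `q` is harmless.
    obtain ⟨j, rfl⟩ : ∃ j, m = j + 1 := ⟨m - 1, by omega⟩
    rw [show a1 = j + 1 by omega, show a2 = j by omega, show b1 = j + 1 by omega,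
      show b2 = j + 1 by omega, show c1 = j + 1 by omega, show c2 = j + 1 by omega,
      show (j + 1 + (j + 1) - 1) / 2 = j by omega, show (j + 1 + (j + 1)) / 2 = j + 1 by omega]
    simp only [map_mul, map_add, map_pow, map_one]
    ring
  · simp only [if_neg (Nat.not_even_iff_odd.mpr hk)] at ht hf ⊢
    obtain ⟨m, rfl⟩ := hk
    simp only [if_true, Bool.false_eq_true, if_false] at ht hf
    rw [show a1 = m by omega, show a2 = m by omega, show b1 = m + 1 by omega,
      show b2 = m by omega, show c1 = m by omega, show c2 = m + 1 by omega,
      show (2 * m + 1 - 1) / 2 = m by omega, show (2 * m + 1) / 2 = m by omega]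
    simp only [map_mul, map_pow, map_one]
    ring

theorem killCompl_chromaticQuasisymmetric [Fintype G.ConnectedComponent]
    (hG : ∀ x u v y, x ≤ u → u < v → v ≤ y → G.Adj x y → G.Adj u v) (hcf : G.CliqueFree 3) :
    MvPowerSeries.killCompl (finPNat 2) (chromaticQuasisymmetric G) =
      ((∏ C : G.ConnectedComponent, compPoly C : MvPolynomial (Fin 2) ℚ[X]) :
        MvPowerSeries (Fin 2) ℚ[X]) := by
  classical
  have hp := isSigning_parity hG hcf
  set f0 : Fin n → ℤ := fun v => (-1) ^ (v : ℕ)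
  have hprod : (∏ C : G.ConnectedComponent, compPoly C : MvPolynomial (Fin 2) ℚ[X]) =
      ∑ g : G.ConnectedComponent → Bool,
        monomial (∑ C : G.ConnectedComponent, compWeight (resign f0 g) C)
          (Polynomial.X ^ ascents G (signColoring (isSigning_resign hp g)) : ℚ[X]) := by
    have h1 : ∀ C : G.ConnectedComponent, compPoly C = ∑ s : Bool,
        monomial (compWeight (resign f0 fun _ : G.ConnectedComponent => s) C)
          (Polynomial.X ^ ((compEdges C).filter fun p =>
            resign f0 (fun _ : G.ConnectedComponent => s) p.1 = 1).card : ℚ[X]) := fun C =>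
      (sum_monomial_compWeight hG C _ (fun s => isSigning_resign hp _)
        fun s => resign_compMin hp _ C).symm
    simp_rw [h1]
    rw [Finset.prod_univ_sum, Fintype.piFinset_univ]
    refine Finset.sum_congr rfl fun g _ => ?_
    rw [ascents_signColoring, ← Finset.prod_pow_eq_pow_sum, monomial_sum_prod]
    -- On `C` only the value `g C` matters, so the factor of `C` may be computed with a constant
    -- choice of signs.
    have h2 : ∀ (C : G.ConnectedComponent) (v : Fin n), v ∈ compSet C →
        resign f0 (fun _ : G.ConnectedComponent => g C) v = resign f0 g v := by
      intro C v hv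
      rw [mem_compSet] at hv
      rw [resign, resign, hv]
    refine Finset.prod_congr rfl fun C _ => ?_
    congr 2
    · unfold compWeight
      congr 3
      · exact Finset.filter_congr fun v hv => by rw [h2 C v hv]
      · exact Finset.filter_congr fun v hv => by rw [h2 C v hv]
    · congr 1
      exact Finset.filter_congr fun p hp => by rw [h2 C _ (mem_compEdges.mp hp).2]
  rw [hprod]
  ext1 d
  rw [MvPowerSeries.coeff_killCompl, MvPolynomial.coeff_coe, coeff_sum]
  simp_rw [coeff_monomial]
  rw [← Finset.sum_filter]
  symm
  -- Choices of a sign for each component correspond bijectively to colorings by 1 and 2.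
  refine Finset.sum_bij (fun g _ => signColoring (isSigning_resign hp g)) ?_ ?_ ?_
    fun _ _ => rfl
  · intro g hg
    rw [Finset.mem_filter] at hg
    rw [Set.Finite.mem_toFinset]
    change colorWeight G _ = _
    rw [colorWeight_signColoring, hg.2]
  · intro g _ g' _ h
    funext C
    have h1 := DFunLike.congr_fun h (compMin C)
    rw [signColoring_apply, signColoring_apply, resign_compMin hp, resign_compMin hp] at h1
    cases hgC : g C <;> cases hgC' : g' C <;> simp [hgC, hgC'] at h1 ⊢
  · intro κ hκ
    rw [Set.Finite.mem_toFinset] at hκ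
    have hκ' : colorWeight G κ = Finsupp.embDomain (finPNat 2) d := hκ
    have h12 := coloring_eq_or_of_colorWeight κ d hκ'
    set g : G.ConnectedComponent → Bool :=
      fun C => decide ((if κ (compMin C) = 1 then (1 : ℤ) else -1) = 1)
    have heq : signColoring (isSigning_resign hp g) = κ := by
      rw [← signColoring_isSigning_of_coloring κ h12]
      apply DFunLike.coe_injective
      funext v
      rw [signColoring_apply, signColoring_apply,
        eq_resign hp (isSigning_of_coloring κ h12) v]
    refine ⟨g, ?_, heq⟩
    rw [Finset.mem_filter]
    refine ⟨Finset.mem_univ _, ?_⟩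
    have h3 := colorWeight_signColoring (isSigning_resign hp g)
    rw [heq, hκ'] at h3
    exact (Finsupp.embDomain_injective _ h3).symm

end TwoVariables

/-! ### Unimodality and the single surviving monomial -/

section TwoColumn

open SimpleGraph

theorem isUnimodal_zero : IsUnimodal 0 := ⟨0, by simp, by simp⟩

theorem isUnimodal_X_pow_mul_one_add_X_pow (r m : ℕ) :
    IsUnimodal (Polynomial.X ^ r * (1 + Polynomial.X) ^ m) := by
  have hc : ∀ a, (Polynomial.X ^ r * (1 + Polynomial.X) ^ m : ℚ[X]).coeff a =
      if r ≤ a then (m.choose (a - r) : ℚ) else 0 := by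
    intro a
    rw [Polynomial.coeff_X_pow_mul']
    simp [Polynomial.coeff_one_add_X_pow]
  -- From `(i+1) * choose m (i+1) = (m-i) * choose m i`, the coefficients rise as long as `i + 1 ≤ m
  -- - i`.
  have hup : ∀ i, i < m / 2 → m.choose i ≤ m.choose (i + 1) := by
    intro i hi
    have h := Nat.choose_succ_right_eq m i
    refine Nat.le_of_mul_le_mul_right ?_ (Nat.succ_pos i)
    rw [Nat.succ_eq_add_one, h]
    exact Nat.mul_le_mul_left _ (by omega)
  have hdown : ∀ i, m / 2 ≤ i → m.choose (i + 1) ≤ m.choose i := by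
    intro i hi
    have h := Nat.choose_succ_right_eq m i
    refine Nat.le_of_mul_le_mul_right ?_ (Nat.succ_pos i)
    rw [Nat.succ_eq_add_one, h]
    exact Nat.mul_le_mul_left _ (by omega)
  refine ⟨r + m / 2, ?_, ?_⟩
  · intro a b hab hb
    rw [hc, hc]
    by_cases ha : r ≤ a
    · rw [if_pos ha, if_pos (ha.trans hab)]
      norm_cast
      obtain ⟨i, rfl⟩ := Nat.exists_eq_add_of_le ha
      obtain ⟨k, rfl⟩ := Nat.exists_eq_add_of_le (ha.trans hab)
      simp only [Nat.add_sub_cancel_left]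
      have hik : i ≤ k := by omega
      clear hab ha
      induction k, hik using Nat.le_induction with
      | base => exact le_rfl
      | succ k hk ih => exact (ih (by omega)).trans (hup k (by omega))
    · rw [if_neg ha]
      split_ifs <;> positivity
  · intro a b ha hab
    rw [hc, hc, if_pos (by omega : r ≤ a), if_pos (by omega : r ≤ b)]
    norm_cast
    have hik : a - r ≤ b - r := by omega
    have hi : m / 2 ≤ a - r := by omega
    generalize a - r = i at *
    generalize b - r = k at *
    induction k, hik using Nat.le_induction with
    | base => exact le_rfl
    | succ k hk ih => exact (hdown k (by omega)).trans ih

variable {n : ℕ} (G : SimpleGraph (Fin n)) [Fintype G.ConnectedComponent]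

theorem numEvenComponents_eq : numEvenComponents G =
    (Finset.univ.filter fun C : G.ConnectedComponent => Even (compSet C).card).card := by
  rw [numEvenComponents, ← Set.ncard_coe_finset]
  congr 1
  ext C
  simp [card_compSet]

theorem numOddComponents_eq : numOddComponents G =
    (Finset.univ.filter fun C : G.ConnectedComponent => ¬ Even (compSet C).card).card := by
  rw [numOddComponents, ← Set.ncard_coe_finset]
  congr 1
  ext C
  simp [card_compSet]

theorem sum_card_compSet : ∑ C : G.ConnectedComponent, (compSet C).card = n := by
  have h := card_filter_eq_sum_compSet G fun _ => True
  simp only [Finset.filter_true, Finset.card_univ, Fintype.card_fin] at h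
  exact h.symm

theorem two_mul_sum_half_add :
    2 * (∑ C : G.ConnectedComponent, (compSet C).card / 2) + numOddComponents G = n := by
  conv_rhs => rw [← sum_card_compSet G]
  rw [numOddComponents_eq, Finset.card_filter, Finset.mul_sum, ← Finset.sum_add_distrib]
  refine Finset.sum_congr rfl fun C _ => ?_
  simp only [Nat.even_iff]
  split_ifs <;> omega

/-- An even component loses 2 and an odd one loses 1 in rounding, which is why `(n - 2n_e - n_o)/2`
is a natural number: it is the total exponent of `q`. -/
theorem two_mul_sum_half_sub_one_add :
    2 * (∑ C : G.ConnectedComponent, ((compSet C).card - 1) / 2) + 2 * numEvenComponents G +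
      numOddComponents G = n := by
  conv_rhs => rw [← sum_card_compSet G]
  rw [numOddComponents_eq, numEvenComponents_eq, Finset.card_filter, Finset.card_filter,
    Finset.mul_sum, Finset.mul_sum, ← Finset.sum_add_distrib, ← Finset.sum_add_distrib]
  refine Finset.sum_congr rfl fun C _ => ?_
  have := (compSet_nonempty C).card_pos
  simp only [Nat.even_iff]
  split_ifs <;> omega

/-- The exponents of `e_1` and `e_2` in the restriction of `X_P` to two variables. -/
noncomputable def twoColumnExp : Fin 2 →₀ ℕ :=
  Finsupp.single 0 (numOddComponents G) +
    Finsupp.single 1 (∑ C : G.ConnectedComponent, (compSet C).card / 2)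

theorem prod_compPoly_eq :
    ∏ C : G.ConnectedComponent, compPoly C =
      ((MvPolynomial.esymmAlgHom (Fin 2) ℚ[X] 2 (MvPolynomial.monomial (twoColumnExp G)
        (Polynomial.X ^ (∑ C : G.ConnectedComponent, ((compSet C).card - 1) / 2) *
          (1 + Polynomial.X) ^ numEvenComponents G)) :
        MvPolynomial.symmetricSubalgebra (Fin 2) ℚ[X]) : MvPolynomial (Fin 2) ℚ[X]) := by
  have h2 : MvPolynomial.esymm (Fin 2) ℚ[X] 2 = MvPolynomial.X 0 * MvPolynomial.X 1 := by
    have h : (Finset.univ : Finset (Fin 2)).powersetCard 2 = {Finset.univ} :=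
      Finset.powersetCard_self Finset.univ
    rw [MvPolynomial.esymm, h, Finset.sum_singleton, Fin.prod_univ_two]
  rw [MvPolynomial.esymmAlgHom_apply, MvPolynomial.aeval_monomial,
    Finsupp.prod_fintype _ _ (by simp), Fin.prod_univ_two]
  simp only [compPoly, twoColumnExp, Finset.prod_mul_distrib, ← map_prod,
    Finset.prod_pow_eq_pow_sum, Finset.prod_ite, Finset.prod_const,
    one_pow, one_mul, mul_one, ← numEvenComponents_eq, ← numOddComponents_eq]
  simp [h2, MvPolynomial.esymm_one, Fin.sum_univ_two, MvPolynomial.algebraMap_eq]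
  left
  ring


end TwoColumn

/-! ### Reading off the two-column coefficients -/

/-- Algebraic independence of `e_1` and `e_2` in two variables turns equality of the restrictions
into equality of polynomials in `e_1, e_2`. -/
theorem expansion_partPoly_two {n : ℕ} {P : NaturalUnitIntervalOrder n} {c : n.Partition → ℚ[X]}
    (hc : IsElementaryExpansion P c) [Fintype P.inc.ConnectedComponent]
    [Decidable (P.inc.CliqueFree 3)] :
    partPoly 2 c = if P.inc.CliqueFree 3 then MvPolynomial.monomial (twoColumnExp P.inc)
        (Polynomial.X ^ (∑ C : P.inc.ConnectedComponent, ((SimpleGraph.compSet C).card - 1) / 2) *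
          (1 + Polynomial.X) ^ numEvenComponents P.inc) else 0 := by
  apply (MvPolynomial.esymmAlgHom_fin_bijective ℚ[X] 2).1
  apply Subtype.ext
  rw [← MvPolynomial.coe_inj, ← killCompl_sum, ← hc]
  split_ifs with h
  · rw [killCompl_chromaticQuasisymmetric P.inc_adj_of_between h, prod_compPoly_eq]
  · rw [killCompl_chromaticQuasisymmetric_eq_zero h]
    simp

theorem conjPart_eq {n k l : ℕ} {lam : n.Partition} (hl : l ≤ k)
    (h : lam.parts = Multiset.replicate l 2 + Multiset.replicate (k - l) 1) :
    conjPart lam 1 = k ∧ conjPart lam 2 = l ∧ k + l = n ∧ expVec 2 lam 0 = k - l ∧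
      expVec 2 lam 1 = l ∧ ∀ p ∈ lam.parts, p ≤ 2 := by
  have hsum := lam.parts_sum
  rw [h] at hsum
  simp only [Multiset.sum_add, Multiset.sum_replicate, smul_eq_mul] at hsum
  refine ⟨?_, ?_, by omega, ?_, ?_, ?_⟩
  · rw [conjPart, Multiset.filter_eq_self (p := fun a => 1 ≤ a) |>.mpr
      fun a ha => Nat.succ_le_of_lt (lam.parts_pos ha), h]
    simp [hl]
  · rw [conjPart, h, Multiset.filter_add, Multiset.filter_eq_self.mpr, Multiset.filter_eq_nil.mpr]
    · simp
    · intro a ha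
      rw [Multiset.eq_of_mem_replicate ha]; norm_num
    · intro a ha
      rw [Multiset.eq_of_mem_replicate ha]
  · rw [expVec_apply, h]
    simp [Multiset.count_replicate]
  · rw [expVec_apply, h]
    simp [Multiset.count_replicate]
  · intro p hp
    rw [h, Multiset.mem_add] at hp
    rcases hp with hp | hp <;> rw [Multiset.eq_of_mem_replicate hp]
    norm_num

open Classical in
theorem mainTheorem10 (n : ℕ) (P : NaturalUnitIntervalOrder n) :
    (∃! c : n.Partition → ℚ[X], IsElementaryExpansion P c) ∧
    ∀ c : n.Partition → ℚ[X], IsElementaryExpansion P c →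
      ∀ lam : n.Partition, IsTwoColumn lam →
        (∃ r : ℕ,
          (r : ℚ) = ((n : ℚ) - 2 * numEvenComponents P.inc - numOddComponents P.inc) / 2 ∧
          c lam =
            if P.inc.CliqueFree 3 ∧
                (conjPart lam 1 : ℚ) = ((n : ℚ) + numOddComponents P.inc) / 2 ∧
                (conjPart lam 2 : ℚ) = ((n : ℚ) - numOddComponents P.inc) / 2
            then Polynomial.X ^ r * (1 + Polynomial.X) ^ numEvenComponents P.inc
            else 0) ∧
        IsUnimodal (c lam) := by
  refine ⟨P.existsUnique_expansion, fun c hc lam hlam => ?_⟩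
  obtain ⟨k, l, hlk, hparts⟩ := hlam
  obtain ⟨h1, h2, hkl, he0, he1, hle⟩ := conjPart_eq hlk hparts
  set r := ∑ C : P.inc.ConnectedComponent, ((SimpleGraph.compSet C).card - 1) / 2 with hr
  set l0 := ∑ C : P.inc.ConnectedComponent, (SimpleGraph.compSet C).card / 2 with hl0
  have hn1 : 2 * l0 + numOddComponents P.inc = n := two_mul_sum_half_add P.inc
  have hn2 : 2 * r + 2 * numEvenComponents P.inc + numOddComponents P.inc = n :=
    two_mul_sum_half_sub_one_add P.inc
  -- The shape with conjugate `(k, l)` gives `e_1^(k-l) e_2^l`. As `k + l = n` and `2 * l0 + n_o =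
  -- n`, matching exponents is the stated condition on the conjugate.
  have hexp : twoColumnExp P.inc = expVec 2 lam ↔
      (conjPart lam 1 : ℚ) = ((n : ℚ) + numOddComponents P.inc) / 2 ∧
        (conjPart lam 2 : ℚ) = ((n : ℚ) - numOddComponents P.inc) / 2 := by
    have hT0 : twoColumnExp P.inc 0 = numOddComponents P.inc := by simp [twoColumnExp]
    have hT1 : twoColumnExp P.inc 1 = l0 := by simp [twoColumnExp, hl0]
    rw [h1, h2, Finsupp.ext_iff, Fin.forall_fin_two, hT0, hT1, he0, he1, eq_div_iff two_ne_zero,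
      eq_div_iff two_ne_zero, eq_sub_iff_add_eq]
    norm_cast
    omega
  have hclam : c lam = if P.inc.CliqueFree 3 ∧
      (conjPart lam 1 : ℚ) = ((n : ℚ) + numOddComponents P.inc) / 2 ∧
        (conjPart lam 2 : ℚ) = ((n : ℚ) - numOddComponents P.inc) / 2
      then Polynomial.X ^ r * (1 + Polynomial.X) ^ numEvenComponents P.inc else 0 := by
    rw [← coeff_partPoly 2 c lam hle, expansion_partPoly_two hc]
    by_cases hcf : P.inc.CliqueFree 3
    · simp only [hcf, if_true, true_and, MvPolynomial.coeff_monomial, hr, ← hexp]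
    · simp [hcf]
  refine ⟨⟨r, ?_, hclam⟩, ?_⟩
  · have hn3 : (2 * r + 2 * numEvenComponents P.inc + numOddComponents P.inc : ℚ) = n := by
      exact_mod_cast hn2
    linarith
  · rw [hclam]
    split_ifs
    · exact isUnimodal_X_pow_mul_one_add_X_pow _ _
    · exact isUnimodal_zero
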